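/- Let $M=(M_j)_{j\ge 0}$ be a strongly regular sequence of real numbers, that is: $M$ is increasing with $M_0=1$; the sequence $M_{j+1}/M_j$ is increasing; there is $A>0$ with $M_{j+k}\le A^{j+k}M_jM_k$ for all $j,k\in\mathbb N$; and there is $A>0$ with $\sum_{j\ge k}\frac{M_j}{(j+1)M_{j+1}}\le A\,\frac{M_k}{M_{k+1}}$ for all $k\in\mathbb N$. Put $h_M(t)=\inf_{j\ge 0}t^jM_j$ for $t>0$ and $h_M(0)=0$. For a multi-index $J$ write $j=|J|$ for its length. Let $\mathcal C_M(\mathbb R^2)$ be the space of complex-valued $f\in\mathcal C^\infty(\mathbb R^2)$ such that for every compact $K\subset\mathbb R^2$ there are $\sigma>0$, $C>0$ with $|D^Jf(x)|\le C\sigma^j j!M_j$ for all $J\in\mathbb N^2$ and $x\in K$. For a compact set $K$, let $\mathcal C_{M,K,\nu}$ ($\nu\ge 1$ an integer) be the space of functions $f$ that are $\mathcal C^\infty$ on $K$ in the sense of Whitney with $\|f\|_{K,\nu}=\sup_{x\in K,\,J}\frac{|D^Jf(x)|}{\nu^j j!M_j}<\infty$, normed by $\|\cdot\|_{K,\nu}$,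 and let $\mathcal C_M(K)=\bigcup_{\nu\ge1}\mathcal C_{M,K,\nu}$ carry the locally convex inductive limit topology. The space $\mathcal C_M(\mathbb R^2)$ carries the topology of the projective limit of the spaces $\mathcal C_M(K_r)$, where $K_r$ ($r=1,2,\dots$) is the closed ball of radius $r$ centred at $0$. Let $k\ge 2$ be an integer and $\varphi(x)=x_1(x_1^2+x_2^{2k})$ on $\mathbb R^2$. Then: 1. The zero set of $\varphi$ is $X=\{x\in\mathbb R^2: x_1=0\}$, one has $\operatorname{dist}(x,X)=|x_1|$ for all $x$, and no point of $X$ is isolated in $X$. 2. $\varphi$ satisfies the $\mathcal C_M$ Łojasiewicz condition: $\varphi$ is a non-zero element of $\mathcal C_M(\mathbb R^2)$ and, for every compact $K\subset\mathbb R^2$ and every $\lambda>0$, there are $C>0$ and $\sigma>0$ such that $$\left|D^J(1/\varphi)(x)\right|\le\frac{C\sigma^j j!M_j}{h_M(\lambda\operatorname{dist}(x,X))}\qquad\text{for all } J\in\mathbb N^2,\ x\in K\setminus X.$$ 3. The ideal $\varphi\,\mathcal C_M(\mathbb R^2)$ is not closed in $\mathcal C_M(\mathbb R^2)$. In particular,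 the $\mathcal C_M$ Łojasiewicz condition does not imply closedness of the generated ideal when the zeros are not isolated. -/

import Mathlib

open scoped ContDiff Topology

namespace DenjoyCarleman

/-- The real sequence `M` is strongly regular: increasing with `M 0 = 1`, logarithmically convex,
of moderate growth, and strongly non-quasianalytic. -/
structure StronglyRegular (M : ℕ → ℝ) : Prop where
  zero : M 0 = 1
  mono : Monotone M
  logConvex : Monotone fun j => M (j + 1) / M j
  moderateGrowth : ∃ A : ℝ, 0 < A ∧ ∀ j k : ℕ, M (j + k) ≤ A ^ (j + k) * M j * M k
  strongNonQuasianalytic : ∃ A : ℝ, 0 < A ∧ ∀ k : ℕ,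
    Summable (fun j : ℕ => M (k + j) / (((k + j : ℕ) + 1 : ℝ) * M (k + j + 1))) ∧
      ∑' j : ℕ, M (k + j) / (((k + j : ℕ) + 1 : ℝ) * M (k + j + 1)) ≤ A * (M k / M (k + 1))

/-- `h_M(t) = inf_j t ^ j M_j` for `t > 0`, and `h_M(0) = 0`. -/
noncomputable def hFun (M : ℕ → ℝ) (t : ℝ) : ℝ :=
  if 0 < t then ⨅ j : ℕ, t ^ j * M j else 0

/-- The partial derivative `∂g/∂x_i`. -/
noncomputable def partialDeriv {n : ℕ} (i : Fin n) (g : EuclideanSpace ℝ (Fin n) → ℂ) :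
    EuclideanSpace ℝ (Fin n) → ℂ :=
  fun x => fderiv ℝ g x (EuclideanSpace.single i 1)

/-- `D^J f`, obtained by applying each `∂/∂x_i` exactly `J i` times. -/
noncomputable def multiDeriv {n : ℕ} (J : Fin n → ℕ) (f : EuclideanSpace ℝ (Fin n) → ℂ) :
    EuclideanSpace ℝ (Fin n) → ℂ :=
  (List.finRange n).foldr (fun i g => (partialDeriv i)^[J i] g) f

/-- The length `j = j_1 + ⋯ + j_n` of a multi-index. -/
def len {n : ℕ} (J : Fin n → ℕ) : ℕ := ∑ i, J i

/-- The weight `σ ^ j * j! * M_j`, where `j` is the length of `J`. -/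
noncomputable def weight {n : ℕ} (M : ℕ → ℝ) (σ : ℝ) (J : Fin n → ℕ) : ℝ :=
  σ ^ len J * (Nat.factorial (len J) : ℝ) * M (len J)

/-- Membership in the Denjoy-Carleman class `C_M(ℝⁿ)` of Roumieu type (complex-valued functions). -/
def IsClassCM {n : ℕ} (M : ℕ → ℝ) (f : EuclideanSpace ℝ (Fin n) → ℂ) : Prop :=
  ContDiff ℝ ∞ f ∧
    ∀ K : Set (EuclideanSpace ℝ (Fin n)), IsCompact K →
      ∃ σ : ℝ, 0 < σ ∧ ∃ C : ℝ, 0 < C ∧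
        ∀ J : Fin n → ℕ, ∀ x ∈ K, ‖multiDeriv J f x‖ ≤ C * weight M σ J

/-- The zero set of a function. -/
def zeroSet {n : ℕ} (φ : EuclideanSpace ℝ (Fin n) → ℂ) : Set (EuclideanSpace ℝ (Fin n)) :=
  {x | φ x = 0}

/-- The `C_M` Łojasiewicz condition on `ℝⁿ`, for a function with at least one zero
(so that the distance to the zero set is the usual one). -/
def LojasiewiczCondition {n : ℕ} (M : ℕ → ℝ) (φ : EuclideanSpace ℝ (Fin n) → ℂ) : Prop :=
  IsClassCM M φ ∧ φ ≠ 0 ∧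
    ∀ K : Set (EuclideanSpace ℝ (Fin n)), IsCompact K → ∀ lam : ℝ, 0 < lam →
      ∃ C : ℝ, 0 < C ∧ ∃ σ : ℝ, 0 < σ ∧
        ∀ J : Fin n → ℕ, ∀ x ∈ K \ zeroSet φ,
          ‖multiDeriv J (fun y => 1 / φ y) x‖ ≤
            C * weight M σ J / hFun M (lam * Metric.infDist x (zeroSet φ))

/-! Linearity of `D^J` on smooth functions. -/

theorem partialDeriv_contDiff {n : ℕ} (i : Fin n) {f : EuclideanSpace ℝ (Fin n) → ℂ}
    (hf : ContDiff ℝ ∞ f) : ContDiff ℝ ∞ (partialDeriv i f) :=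
  (hf.fderiv_right (m := ∞) (by simp)).clm_apply contDiff_const

theorem iterate_partialDeriv_linear {n : ℕ} (i : Fin n) (k : ℕ) (a b : ℂ)
    {f g : EuclideanSpace ℝ (Fin n) → ℂ} (hf : ContDiff ℝ ∞ f) (hg : ContDiff ℝ ∞ g) :
    ContDiff ℝ ∞ ((partialDeriv i)^[k] f) ∧
      (partialDeriv i)^[k] (a • f + b • g) =
        a • (partialDeriv i)^[k] f + b • (partialDeriv i)^[k] g := by
  induction k generalizing f g with
  | zero => exact ⟨hf, rfl⟩
  | succ k ih =>
    have key : partialDeriv i (a • f + b • g) = a • partialDeriv i f + b • partialDeriv i g := by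
      funext x
      have h1 : DifferentiableAt ℝ f x := (hf.differentiable (by simp)).differentiableAt
      have h2 : DifferentiableAt ℝ g x := (hg.differentiable (by simp)).differentiableAt
      simp only [partialDeriv, Pi.add_apply, Pi.smul_apply]
      rw [fderiv_add (h1.const_smul a) (h2.const_smul b), fderiv_const_smul h1,
        fderiv_const_smul h2]
      rfl
    simp only [Function.iterate_succ_apply, key]
    exact ih (partialDeriv_contDiff i hf) (partialDeriv_contDiff i hg)

theorem foldr_linear {n : ℕ} (J : Fin n → ℕ) (l : List (Fin n)) (a b : ℂ)
    {f g : EuclideanSpace ℝ (Fin n) → ℂ} (hf : ContDiff ℝ ∞ f) (hg : ContDiff ℝ ∞ g) :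
    ContDiff ℝ ∞ (l.foldr (fun i g => (partialDeriv i)^[J i] g) f) ∧
      l.foldr (fun i g => (partialDeriv i)^[J i] g) (a • f + b • g) =
        a • l.foldr (fun i g => (partialDeriv i)^[J i] g) f +
          b • l.foldr (fun i g => (partialDeriv i)^[J i] g) g := by
  induction l generalizing f g with
  | nil => exact ⟨hf, rfl⟩
  | cons i l ih =>
    have hf' := (ih hf hf).1
    have hg' := (ih hg hg).1
    simp only [List.foldr_cons, (ih hf hg).2]
    exact iterate_partialDeriv_linear i (J i) a b hf' hg'

theorem multiDeriv_linear {n : ℕ} (J : Fin n → ℕ) (a b : ℂ)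
    {f g : EuclideanSpace ℝ (Fin n) → ℂ} (hf : ContDiff ℝ ∞ f) (hg : ContDiff ℝ ∞ g) :
    multiDeriv J (a • f + b • g) = a • multiDeriv J f + b • multiDeriv J g :=
  (foldr_linear J _ a b hf hg).2

/-! The topology of `C_M(ℝⁿ)`. -/

/-- Jets on `K`: families of functions on `K` indexed by multi-indices. This is a `def` so that it
carries no topology of its own. -/
def Jet {n : ℕ} (K : Set (EuclideanSpace ℝ (Fin n))) : Type := (Fin n → ℕ) → K → ℂ

instance {n : ℕ} (K : Set (EuclideanSpace ℝ (Fin n))) : AddCommGroup (Jet K) :=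
  inferInstanceAs (AddCommGroup ((Fin n → ℕ) → K → ℂ))

instance {n : ℕ} (K : Set (EuclideanSpace ℝ (Fin n))) : Module ℂ (Jet K) :=
  inferInstanceAs (Module ℂ ((Fin n → ℕ) → K → ℂ))

/-- The jet `(D^J f restricted to K)_J` of a function on `ℝⁿ`. -/
noncomputable def jetOf {n : ℕ} (K : Set (EuclideanSpace ℝ (Fin n)))
    (f : EuclideanSpace ℝ (Fin n) → ℂ) : Jet K :=
  fun J x => multiDeriv J f x

/-- The quotients `|F^J(x)| / (σ ^ j * j! * M_j)`. -/
noncomputable def ratio {n : ℕ} (M : ℕ → ℝ) (K : Set (EuclideanSpace ℝ (Fin n))) (σ : ℝ)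
    (F : Jet K) (p : (Fin n → ℕ) × K) : ℝ :=
  ‖F p.1 p.2‖ / weight M σ p.1

/-- `‖F‖_{K,σ}`, the supremum of `|F^J(x)| / (σ ^ j * j! * M_j)` over `x ∈ K` and all `J`. -/
noncomputable def jetNorm {n : ℕ} (M : ℕ → ℝ) (K : Set (EuclideanSpace ℝ (Fin n))) (σ : ℝ)
    (F : Jet K) : ℝ :=
  ⨆ p : (Fin n → ℕ) × K, ratio M K σ F p

theorem weight_mono {n : ℕ} {M : ℕ → ℝ} {σ τ : ℝ} (hσ : 0 < σ) (hστ : σ ≤ τ) (J : Fin n → ℕ)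
    (hM : 0 ≤ M (len J)) : weight M σ J ≤ weight M τ J := by
  unfold weight
  gcongr

theorem ratio_bdd_of_le {n : ℕ} {M : ℕ → ℝ} {K : Set (EuclideanSpace ℝ (Fin n))} {σ τ : ℝ}
    (hσ : 0 < σ) (hστ : σ ≤ τ) {F : Jet K} (h : BddAbove (Set.range (ratio M K σ F))) :
    BddAbove (Set.range (ratio M K τ F)) := by
  obtain ⟨C, hC⟩ := h
  refine ⟨max C 0, ?_⟩
  rintro _ ⟨p, rfl⟩
  have h1 : ratio M K σ F p ≤ C := hC ⟨p, rfl⟩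
  unfold ratio at h1 ⊢
  have hτ : 0 < τ := hσ.trans_le hστ
  rcases lt_trichotomy (M (len p.1)) 0 with hM | hM | hM
  · refine le_max_of_le_right (div_nonpos_of_nonneg_of_nonpos (norm_nonneg _) ?_)
    exact mul_nonpos_of_nonneg_of_nonpos (by positivity) hM.le
  · simp [weight, hM]
  · refine le_max_of_le_left (le_trans ?_ h1)
    exact div_le_div_of_nonneg_left (norm_nonneg _) (by unfold weight; positivity)
      (weight_mono hσ hστ _ hM.le)

/-- The space `C_{M,K,ν}`: jets on `K` that are `C^∞` on `K` in the sense of Whitney (equivalently,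
jets on `K` of `C^∞` functions on `ℝⁿ`) and satisfy `‖F‖_{K,ν} < ∞`. -/
noncomputable def stepSpace {n : ℕ} (M : ℕ → ℝ) (K : Set (EuclideanSpace ℝ (Fin n))) (ν : ℕ+) :
    Submodule ℂ (Jet K) where
  carrier := {F | (∃ f : EuclideanSpace ℝ (Fin n) → ℂ, ContDiff ℝ ∞ f ∧ F = jetOf K f) ∧
    BddAbove (Set.range (ratio M K (ν : ℝ) F))}
  zero_mem' := by
    refine ⟨⟨0, contDiff_const, ?_⟩, 0, ?_⟩
    · funext J x
      have h := multiDeriv_linear (n := n) J 0 0 (f := 0) (g := 0) contDiff_const contDiff_const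
      simp only [zero_smul, add_zero] at h
      simp only [jetOf, h]
      rfl
    · rintro _ ⟨p, rfl⟩
      have : (0 : Jet K) p.1 p.2 = 0 := rfl
      simp [ratio, this]
  add_mem' := by
    rintro F G ⟨⟨f, hf, rfl⟩, C, hC⟩ ⟨⟨g, hg, rfl⟩, C', hC'⟩
    refine ⟨⟨f + g, hf.add hg, ?_⟩, |C| + |C'|, ?_⟩
    · funext J x
      have h := multiDeriv_linear J 1 1 hf hg
      simp only [one_smul] at h
      simp only [jetOf, h]
      rfl
    · rintro _ ⟨p, rfl⟩
      have h1 : ratio M K ν (jetOf K f) p ≤ C := hC ⟨p, rfl⟩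
      have h2 : ratio M K ν (jetOf K g) p ≤ C' := hC' ⟨p, rfl⟩
      have h3 : ‖(jetOf K f + jetOf K g) p.1 p.2‖ ≤ ‖jetOf K f p.1 p.2‖ + ‖jetOf K g p.1 p.2‖ :=
        norm_add_le _ _
      rcases le_total 0 (weight M ν p.1) with hw | hw
      · calc ratio M K ν (jetOf K f + jetOf K g) p
            ≤ ratio M K ν (jetOf K f) p + ratio M K ν (jetOf K g) p := by
              unfold ratio; rw [← add_div]; gcongr
          _ ≤ |C| + |C'| := add_le_add (h1.trans (le_abs_self _)) (h2.trans (le_abs_self _))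
      · exact (div_nonpos_of_nonneg_of_nonpos (norm_nonneg _) hw).trans (by positivity)
  smul_mem' := by
    rintro c F ⟨⟨f, hf, rfl⟩, C, hC⟩
    refine ⟨⟨c • f, contDiff_const.smul hf, ?_⟩, ‖c‖ * C, ?_⟩
    · funext J x
      have h := multiDeriv_linear J c 0 hf hf
      simp only [zero_smul, add_zero] at h
      simp only [jetOf, h]
      rfl
    · rintro _ ⟨p, rfl⟩
      have h1 : ratio M K ν (jetOf K f) p ≤ C := hC ⟨p, rfl⟩
      have h3 : ‖(c • jetOf K f) p.1 p.2‖ = ‖c‖ * ‖jetOf K f p.1 p.2‖ :=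
        norm_smul c (jetOf K f p.1 p.2)
      have : ratio M K ν (c • jetOf K f) p = ‖c‖ * ratio M K ν (jetOf K f) p := by
        unfold ratio; rw [h3, mul_div_assoc]
      rw [this]
      gcongr

theorem StronglyRegular.pos {M : ℕ → ℝ} (hM : StronglyRegular M) (j : ℕ) : 0 < M j :=
  zero_lt_one.trans_le (hM.zero ▸ hM.mono (Nat.zero_le j))

theorem weight_pos {n : ℕ} {M : ℕ → ℝ} (hM : StronglyRegular M) (ν : ℕ+) (J : Fin n → ℕ) :
    0 < weight M (ν : ℝ) J := by
  have := hM.pos (len J)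
  have : (0 : ℝ) < (ν : ℝ) := by exact_mod_cast ν.pos
  unfold weight
  positivity

theorem ratio_nonneg {n : ℕ} {M : ℕ → ℝ} (hM : StronglyRegular M)
    {K : Set (EuclideanSpace ℝ (Fin n))} (ν : ℕ+) (F : Jet K) (p : (Fin n → ℕ) × K) :
    0 ≤ ratio M K (ν : ℝ) F p :=
  div_nonneg (norm_nonneg _) (weight_pos hM ν p.1).le

/-- The norm `‖·‖_{K,ν}` on `C_{M,K,ν}`. -/
noncomputable def stepNorm {n : ℕ} {M : ℕ → ℝ} (hM : StronglyRegular M)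
    (K : Set (EuclideanSpace ℝ (Fin n))) (ν : ℕ+) : Seminorm ℂ (stepSpace M K ν) :=
  Seminorm.of (fun F => jetNorm M K (ν : ℝ) F.1)
    (by
      intro F G
      refine Real.iSup_le (fun p => ?_) (add_nonneg (Real.iSup_nonneg (ratio_nonneg hM ν F.1))
        (Real.iSup_nonneg (ratio_nonneg hM ν G.1)))
      have h3 : ‖(F.1 + G.1) p.1 p.2‖ ≤ ‖F.1 p.1 p.2‖ + ‖G.1 p.1 p.2‖ := norm_add_le _ _
      have hw := weight_pos hM ν p.1
      calc ratio M K ν (F.1 + G.1) p ≤ ratio M K ν F.1 p + ratio M K ν G.1 p := by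
            unfold ratio; rw [← add_div]; gcongr
        _ ≤ _ := add_le_add (le_ciSup F.2.2 p) (le_ciSup G.2.2 p))
    (by
      intro c F
      have h : ratio M K (ν : ℝ) (c • F.1) = fun p => ‖c‖ * ratio M K ν F.1 p := by
        funext p
        have h3 : ‖(c • F.1) p.1 p.2‖ = ‖c‖ * ‖F.1 p.1 p.2‖ := norm_smul c (F.1 p.1 p.2)
        unfold ratio
        rw [h3, mul_div_assoc]
      change (⨆ p, ratio M K (ν : ℝ) (c • F.1) p) = ‖c‖ * ⨆ p, ratio M K (ν : ℝ) F.1 p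
      rw [h, Real.mul_iSup_of_nonneg (norm_nonneg c)])

/-- The topology of the normed space `C_{M,K,ν}`. -/
noncomputable abbrev stepTopology {n : ℕ} {M : ℕ → ℝ} (hM : StronglyRegular M)
    (K : Set (EuclideanSpace ℝ (Fin n))) (ν : ℕ+) : TopologicalSpace (stepSpace M K ν) :=
  (stepNorm hM K ν).toAddGroupSeminorm.toSeminormedAddCommGroup.toUniformSpace.toTopologicalSpace

theorem stepSpace_mono {n : ℕ} (M : ℕ → ℝ) (K : Set (EuclideanSpace ℝ (Fin n))) {ν ν' : ℕ+}
    (h : ν ≤ ν') : stepSpace M K ν ≤ stepSpace M K ν' := fun _ hF =>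
  ⟨hF.1, ratio_bdd_of_le (by exact_mod_cast ν.pos) (by exact_mod_cast h) hF.2⟩

/-- The space `C_M(K)`, the union of the spaces `C_{M,K,ν}` over the integers `ν ≥ 1`. -/
noncomputable def localClass {n : ℕ} (M : ℕ → ℝ) (K : Set (EuclideanSpace ℝ (Fin n))) :
    Submodule ℂ (Jet K) where
  carrier := {F | ∃ ν : ℕ+, F ∈ stepSpace M K ν}
  zero_mem' := ⟨1, Submodule.zero_mem _⟩
  add_mem' := by
    rintro F G ⟨ν, hF⟩ ⟨μ, hG⟩
    exact ⟨max ν μ, Submodule.add_mem _ (stepSpace_mono M K (le_max_left ν μ) hF)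
      (stepSpace_mono M K (le_max_right ν μ) hG)⟩
  smul_mem' := by
    rintro c F ⟨ν, hF⟩
    exact ⟨ν, Submodule.smul_mem _ c hF⟩

/-- The inclusion of `C_{M,K,ν}` in `C_M(K)`. -/
noncomputable def stepInclusion {n : ℕ} (M : ℕ → ℝ) (K : Set (EuclideanSpace ℝ (Fin n)))
    (ν : ℕ+) : stepSpace M K ν → localClass M K :=
  fun F => ⟨F.1, ν, F.2⟩

/-- The inductive limit topology of `C_M(K)`: the finest locally convex vector space topology for
which all the inclusions of the normed spaces `C_{M,K,ν}` are continuous. -/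
noncomputable abbrev localTopology {n : ℕ} {M : ℕ → ℝ} (hM : StronglyRegular M)
    (K : Set (EuclideanSpace ℝ (Fin n))) : TopologicalSpace (localClass M K) :=
  sInf {t | @IsTopologicalAddGroup (localClass M K) t _ ∧
    @ContinuousSMul ℂ (localClass M K) _ _ t ∧
    @LocallyConvexSpace ℝ (localClass M K) _ _ _ _ t ∧
    ∀ ν : ℕ+, @Continuous _ _ (stepTopology hM K ν) t (stepInclusion M K ν)}

/-- The Denjoy-Carleman class `C_M(ℝⁿ)`. -/
structure ClassCM (n : ℕ) (M : ℕ → ℝ) where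
  toFun : EuclideanSpace ℝ (Fin n) → ℂ
  isClassCM : IsClassCM M toFun

instance {n : ℕ} {M : ℕ → ℝ} : CoeFun (ClassCM n M) fun _ => EuclideanSpace ℝ (Fin n) → ℂ :=
  ⟨ClassCM.toFun⟩

/-- The restriction map from `C_M(ℝⁿ)` to `C_M(K)`, for `K` compact. -/
noncomputable def ClassCM.restrict {n : ℕ} {M : ℕ → ℝ} (K : Set (EuclideanSpace ℝ (Fin n)))
    (hK : IsCompact K) (f : ClassCM n M) : localClass M K :=
  ⟨jetOf K f, by
    obtain ⟨hf, h⟩ := f.isClassCM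
    obtain ⟨σ, hσ, C, hC, hb⟩ := h K hK
    obtain ⟨N, hN⟩ := exists_nat_ge σ
    have hσ' : σ ≤ ((N.succPNat : ℕ+) : ℝ) := by
      simp only [Nat.succPNat_coe, Nat.cast_succ]
      linarith
    refine ⟨N.succPNat, ⟨f, hf, rfl⟩, ratio_bdd_of_le hσ hσ' ⟨C, ?_⟩⟩
    rintro _ ⟨p, rfl⟩
    have h1 := hb p.1 p.2 p.2.2
    have h2 : 0 ≤ weight M σ p.1 :=
      nonneg_of_mul_nonneg_right ((norm_nonneg _).trans h1) hC
    exact div_le_of_le_mul₀ h2 hC.le h1⟩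

/-- The topology of `C_M(ℝⁿ)`: the projective limit of the spaces `C_M(K)` along the exhaustion of
`ℝⁿ` by the closed balls of radius `1, 2, 3, …` centred at the origin (which are convex, hence
Whitney 1-regular). -/
noncomputable abbrev ClassCM.topology {n : ℕ} {M : ℕ → ℝ} (hM : StronglyRegular M) :
    TopologicalSpace (ClassCM n M) :=
  ⨅ r : ℕ+, (localTopology hM (Metric.closedBall 0 (r : ℝ))).induced
    (ClassCM.restrict (Metric.closedBall 0 (r : ℝ)) (isCompact_closedBall 0 (r : ℝ)))

/-- The principal ideal `φ C_M(ℝⁿ)`, as a subset of `C_M(ℝⁿ)`. -/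
def principalIdeal {n : ℕ} (M : ℕ → ℝ) (φ : EuclideanSpace ℝ (Fin n) → ℂ) :
    Set (ClassCM n M) :=
  {f | ∃ g : ClassCM n M, ∀ x, f x = φ x * g x}

/-- The function `φ(x) = x₁ (x₁ ^ 2 + x₂ ^ (2k))` on `ℝ²`. -/
noncomputable def exampleFun (k : ℕ) : EuclideanSpace ℝ (Fin 2) → ℂ :=
  fun x => ((x 0 * (x 0 ^ 2 + x 1 ^ (2 * k)) : ℝ) : ℂ)

end DenjoyCarleman

/-! Write x₁, x₂ for `x 0`, `x 1`, and φ = x₁ψ with ψ = x₁² + x₂^(2k), s = √ψ, t = |x₁|.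

Łojasiewicz condition. On a bounded set |x₁| ≤ s and |x₂|^k ≤ s force the Taylor coefficients of ψ
of order j at x to be at most ψ(x)(κ/s)^j (`norm_taylorCoeff_secondFactor_le`), and an inverse
inherits bounds of this Cauchy type with κ replaced by 4κ (`HasTaylorBound.of_mul_eq_one`). The same
applies to 1/x₁ at scale t ≤ s, so the coefficients of 1/φ are O(ρ^j t^(-j-3)). Finally h_M(λt) ≤
(λt)^(j+3) M_(j+3), and moderate growth bounds M_(j+3) by a geometric factor times M_j.

Failure of closedness. Let f = x₁u(x₂), where u = ∑ e_n is a sum of pulses, e_n being centred at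
2^(-n) and zero for x₂ ≤ 2^(-n-1). A partial sum vanishes for x₂ ≤ 2^(-N), so its quotient by ψ
stays in the class and the corresponding product lies in the ideal; these products converge to f
(`tendsto_classCM`). If f = φg, then ψg = u(x₂), and expanding in x₁ at (0, t) shows that the
coefficient of x₁^(2m) in g is (-1)^m u(t)/t^(2k(m+1)). Hence u(t) ≤ C τ^(2m) t^(2k(m+1)) M_(2m) for
every m: u would have to be much flatter at 0 than membership in the class requires.

The pulses prevent this (`StronglyRegular.exists_pulses`). With q = M^(1/4), again strongly regular
by two uses of `StronglyRegular.sqrt`, a bump of class q is rescaled to width δ = 2^(-n-1) and given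
height 2^(-n) inf_j δ^j q_j³. Its derivatives are then controlled by q_m³ · q_m = M_m, while
u(2^(-n)) is at least about δ^j M_j^(3/4) for some j. Taking m near 3j/8 gives M_(2m) ≤ M_j^(3/4),
whereas t^(2k(m+1)) ≤ t^(4m+4) gains about t^(j/2) over t^(j+1). This is where k ≥ 2 is needed, and
it is contradictory for large n (`StronglyRegular.false_of_bounds`). -/

namespace DenjoyCarleman

/-! ### Leibniz calculus for germs of iterated partial derivatives -/

section PartialDerivatives

variable {n : ℕ} {f g : EuclideanSpace ℝ (Fin n) → ℂ} {x : EuclideanSpace ℝ (Fin n)}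

theorem partialDeriv_contDiffAt (i : Fin n) (hf : ContDiffAt ℝ ∞ f x) :
    ContDiffAt ℝ ∞ (partialDeriv i f) x :=
  (hf.fderiv_right (m := ∞) (by simp)).clm_apply contDiffAt_const

theorem iterate_partialDeriv_contDiffAt (i : Fin n) (m : ℕ) (hf : ContDiffAt ℝ ∞ f x) :
    ContDiffAt ℝ ∞ ((partialDeriv i)^[m] f) x := by
  induction m with
  | zero => exact hf
  | succ m ih =>
    rw [Function.iterate_succ_apply']
    exact partialDeriv_contDiffAt i ih

theorem partialDeriv_congr (i : Fin n) (h : f =ᶠ[𝓝 x] g) :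
    partialDeriv i f =ᶠ[𝓝 x] partialDeriv i g := by
  filter_upwards [h.fderiv (𝕜 := ℝ)] with y hy
  simp [partialDeriv, hy]

theorem iterate_partialDeriv_congr (i : Fin n) (m : ℕ) (h : f =ᶠ[𝓝 x] g) :
    (partialDeriv i)^[m] f =ᶠ[𝓝 x] (partialDeriv i)^[m] g := by
  induction m with
  | zero => exact h
  | succ m ih =>
    simp only [Function.iterate_succ_apply']
    exact partialDeriv_congr i ih

theorem eventually_differentiableAt (hf : ContDiffAt ℝ ∞ f x) :
    ∀ᶠ y in 𝓝 x, DifferentiableAt ℝ f y := by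
  filter_upwards [(hf.of_le (m := 1) (by simp)).eventually (by simp)] with y hy
  exact hy.differentiableAt (by simp)

theorem partialDeriv_mul (i : Fin n) (hf : ContDiffAt ℝ ∞ f x) (hg : ContDiffAt ℝ ∞ g x) :
    partialDeriv i (fun y => f y * g y) =ᶠ[𝓝 x]
      fun y => partialDeriv i f y * g y + f y * partialDeriv i g y := by
  filter_upwards [eventually_differentiableAt hf, eventually_differentiableAt hg] with y h1 h2
  simp only [partialDeriv]
  rw [fderiv_fun_mul h1 h2]
  simp
  ring

theorem partialDeriv_sum {ι : Type*} (i : Fin n) (s : Finset ι) (c : ι → ℂ)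
    (F : ι → EuclideanSpace ℝ (Fin n) → ℂ) (hF : ∀ j ∈ s, ContDiffAt ℝ ∞ (F j) x) :
    partialDeriv i (fun y => ∑ j ∈ s, c j * F j y) =ᶠ[𝓝 x]
      fun y => ∑ j ∈ s, c j * partialDeriv i (F j) y := by
  have h : ∀ᶠ y in 𝓝 x, ∀ j ∈ s, DifferentiableAt ℝ (F j) y :=
    (Filter.eventually_all_finset s).2 fun j hj => eventually_differentiableAt (hF j hj)
  filter_upwards [h] with y hy
  simp only [partialDeriv]
  rw [fderiv_fun_sum fun j hj => (hy j hj).const_mul (c j)]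
  simp only [sum_apply]
  refine Finset.sum_congr rfl fun j hj => ?_
  rw [fderiv_const_mul (hy j hj)]
  simp

theorem iterate_partialDeriv_sum {ι : Type*} (i : Fin n) (m : ℕ) (s : Finset ι) (c : ι → ℂ)
    (F : ι → EuclideanSpace ℝ (Fin n) → ℂ) (hF : ∀ j ∈ s, ContDiffAt ℝ ∞ (F j) x) :
    (partialDeriv i)^[m] (fun y => ∑ j ∈ s, c j * F j y) =ᶠ[𝓝 x]
      fun y => ∑ j ∈ s, c j * (partialDeriv i)^[m] (F j) y := by
  induction m with
  | zero => rfl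
  | succ m ih =>
    simp only [Function.iterate_succ_apply']
    exact (partialDeriv_congr i ih).trans (partialDeriv_sum i s c _
      fun j hj => iterate_partialDeriv_contDiffAt i m (hF j hj))

theorem iterate_partialDeriv_mul (i : Fin n) (m : ℕ) (hf : ContDiffAt ℝ ∞ f x)
    (hg : ContDiffAt ℝ ∞ g x) :
    (partialDeriv i)^[m] (fun y => f y * g y) =ᶠ[𝓝 x]
      fun y => ∑ p ∈ Finset.HasAntidiagonal.antidiagonal m, (m.choose p.1 : ℂ) *
        ((partialDeriv i)^[p.1] f y * (partialDeriv i)^[p.2] g y) := by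
  induction m with
  | zero => simp
  | succ m ih =>
    rw [Function.iterate_succ_apply']
    have h1 : ∀ p ∈ Finset.HasAntidiagonal.antidiagonal m, ∀ᶠ y in 𝓝 x,
        partialDeriv i (fun y => (partialDeriv i)^[p.1] f y * (partialDeriv i)^[p.2] g y) y =
          (partialDeriv i)^[p.1 + 1] f y * (partialDeriv i)^[p.2] g y +
            (partialDeriv i)^[p.1] f y * (partialDeriv i)^[p.2 + 1] g y := fun p _ => by
      simp only [Function.iterate_succ_apply']
      exact partialDeriv_mul i (iterate_partialDeriv_contDiffAt i _ hf)
        (iterate_partialDeriv_contDiffAt i _ hg)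
    refine ((partialDeriv_congr i ih).trans (partialDeriv_sum i _ _ _ fun p _ =>
      (iterate_partialDeriv_contDiffAt i _ hf).mul
        (iterate_partialDeriv_contDiffAt i _ hg))).trans ?_
    filter_upwards [(Filter.eventually_all_finset _).2 h1] with y hy
    -- Pascal's rule in antidiagonal form; one of its two sums carries the binomial coefficient
    -- indexed by `p.2`, whence the use of symmetry below.
    rw [Finset.sum_antidiagonal_choose_succ_mul
      (fun a b => (partialDeriv i)^[a] f y * (partialDeriv i)^[b] g y) m, ← Finset.sum_add_distrib]
    refine Finset.sum_congr rfl fun p hp => ?_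
    rw [hy p hp, Nat.choose_symm_of_eq_add (Finset.HasAntidiagonal.mem_antidiagonal.1 hp).symm]
    ring

end PartialDerivatives

/-! ### Taylor coefficients in two variables -/

section TaylorCoefficients

variable {f g : EuclideanSpace ℝ (Fin 2) → ℂ} {x : EuclideanSpace ℝ (Fin 2)}

/-- The Taylor coefficient of index `(a, b)` of a function of two variables at `x`. -/
noncomputable def taylorCoeff (f : EuclideanSpace ℝ (Fin 2) → ℂ) (x : EuclideanSpace ℝ (Fin 2))
    (a b : ℕ) : ℂ :=
  (partialDeriv 0)^[a] ((partialDeriv 1)^[b] f) x / (a.factorial * b.factorial : ℂ)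

theorem multiDeriv_eq_taylorCoeff (f : EuclideanSpace ℝ (Fin 2) → ℂ) (J : Fin 2 → ℕ) :
    multiDeriv J f x =
      ((J 0).factorial * (J 1).factorial : ℂ) * taylorCoeff f x (J 0) (J 1) := by
  have h0 : ((J 0).factorial : ℂ) ≠ 0 := by exact_mod_cast (J 0).factorial_ne_zero
  have h1 : ((J 1).factorial : ℂ) ≠ 0 := by exact_mod_cast (J 1).factorial_ne_zero
  rw [taylorCoeff, mul_div_cancel₀ _ (mul_ne_zero h0 h1)]
  simp [multiDeriv, List.finRange_succ]

theorem taylorCoeff_congr (h : f =ᶠ[𝓝 x] g) (a b : ℕ) :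
    taylorCoeff f x a b = taylorCoeff g x a b := by
  rw [taylorCoeff, taylorCoeff,
    (iterate_partialDeriv_congr 0 a (iterate_partialDeriv_congr 1 b h)).eq_of_nhds]

theorem taylorCoeff_zero_zero : taylorCoeff f x 0 0 = f x := by simp [taylorCoeff]

theorem taylorCoeff_sum {ι : Type*} (s : Finset ι) (c : ι → ℂ)
    (F : ι → EuclideanSpace ℝ (Fin 2) → ℂ) (hF : ∀ j ∈ s, ContDiffAt ℝ ∞ (F j) x) (a b : ℕ) :
    taylorCoeff (fun y => ∑ j ∈ s, c j * F j y) x a b = ∑ j ∈ s, c j * taylorCoeff (F j) x a b := by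
  have h := ((iterate_partialDeriv_congr 0 a (iterate_partialDeriv_sum 1 b s c F hF)).trans
    (iterate_partialDeriv_sum 0 a s c _
      fun j hj => iterate_partialDeriv_contDiffAt 1 b (hF j hj))).eq_of_nhds
  rw [taylorCoeff, h, Finset.sum_div]
  exact Finset.sum_congr rfl fun j _ => mul_div_assoc _ _ _

theorem taylorCoeff_add (hf : ContDiffAt ℝ ∞ f x) (hg : ContDiffAt ℝ ∞ g x) (a b : ℕ) :
    taylorCoeff (fun y => f y + g y) x a b = taylorCoeff f x a b + taylorCoeff g x a b := by
  have h := taylorCoeff_sum (x := x) Finset.univ (fun _ : Fin 2 => 1) ![f, g]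
    (by intro j _; fin_cases j <;> assumption) a b
  simpa [Fin.sum_univ_two] using h

/-- Division by the factorials turns the Leibniz rule into a Cauchy product without binomial
coefficients. This is why all estimates are made on Taylor coefficients instead of derivatives. -/
theorem taylorCoeff_mul (hf : ContDiffAt ℝ ∞ f x) (hg : ContDiffAt ℝ ∞ g x) (a b : ℕ) :
    taylorCoeff (fun y => f y * g y) x a b =
      ∑ p ∈ Finset.HasAntidiagonal.antidiagonal a, ∑ q ∈ Finset.HasAntidiagonal.antidiagonal b,
        taylorCoeff f x p.1 q.1 * taylorCoeff g x p.2 q.2 := by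
  have h1 := ((iterate_partialDeriv_congr 0 a (iterate_partialDeriv_mul 1 b hf hg)).trans
    (iterate_partialDeriv_sum 0 a _ _ _ fun q _ =>
      (iterate_partialDeriv_contDiffAt 1 q.1 hf).mul
        (iterate_partialDeriv_contDiffAt 1 q.2 hg))).eq_of_nhds
  rw [taylorCoeff, h1, Finset.sum_div, Finset.sum_comm]
  refine Finset.sum_congr rfl fun q hq => ?_
  rw [(iterate_partialDeriv_mul 0 a (iterate_partialDeriv_contDiffAt 1 q.1 hf)
    (iterate_partialDeriv_contDiffAt 1 q.2 hg)).eq_of_nhds, Finset.mul_sum, Finset.sum_div]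
  refine Finset.sum_congr rfl fun p hp => ?_
  have key : ∀ {m : ℕ} {r : ℕ × ℕ}, r ∈ Finset.HasAntidiagonal.antidiagonal m →
      (m.choose r.1 : ℂ) * (r.1.factorial * r.2.factorial) = m.factorial := by
    intro m r hr
    obtain rfl := Finset.HasAntidiagonal.mem_antidiagonal.1 hr
    have := Nat.choose_mul_factorial_mul_factorial (Nat.le_add_right r.1 r.2)
    rw [Nat.add_sub_cancel_left] at this
    rw [← mul_assoc]
    exact_mod_cast this
  have hne : ∀ m : ℕ, (m.factorial : ℂ) ≠ 0 := fun m => by exact_mod_cast m.factorial_ne_zero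
  have hp1 := hne p.1
  have hp2 := hne p.2
  have hq1 := hne q.1
  have hq2 := hne q.2
  have hc : ∀ {m : ℕ} {r : ℕ × ℕ}, r ∈ Finset.HasAntidiagonal.antidiagonal m → (m.choose r.1 : ℂ) ≠ 0 :=
    fun {m r} hr => by
      have := (Nat.choose_pos (Nat.le.intro (Finset.HasAntidiagonal.mem_antidiagonal.1 hr))).ne'
      exact_mod_cast this
  have hcp := hc hp
  have hcq := hc hq
  simp only [taylorCoeff]
  rw [← key hp, ← key hq]
  field_simp

/-- Taylor coefficients of products of functions of one variable. -/
theorem iterate_partialDeriv_tensor {p q : ℝ → ℂ} (hp : ContDiff ℝ ∞ p) (hq : ContDiff ℝ ∞ q)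
    (a b : ℕ) :
    (partialDeriv 0)^[a] ((partialDeriv 1)^[b]
      (fun x : EuclideanSpace ℝ (Fin 2) => p (x 0) * q (x 1))) =
      fun x => iteratedDeriv a p (x 0) * iteratedDeriv b q (x 1) := by
  have hit : ∀ {u : ℝ → ℂ}, ContDiff ℝ ∞ u → ∀ m, Differentiable ℝ (iteratedDeriv m u) :=
    fun hu m => hu.differentiable_iteratedDeriv m (by exact_mod_cast WithTop.coe_lt_top _)
  have hproj : ∀ (i : Fin 2) (x : EuclideanSpace ℝ (Fin 2)),
      HasFDerivAt (fun x : EuclideanSpace ℝ (Fin 2) => x i)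
        (EuclideanSpace.proj i : EuclideanSpace ℝ (Fin 2) →L[ℝ] ℝ) x :=
    fun i x => (EuclideanSpace.proj i : EuclideanSpace ℝ (Fin 2) →L[ℝ] ℝ).hasFDerivAt
  have hcomp : ∀ {u : ℝ → ℂ}, Differentiable ℝ u → ∀ (i j : Fin 2) (x : EuclideanSpace ℝ (Fin 2)),
      DifferentiableAt ℝ (fun x : EuclideanSpace ℝ (Fin 2) => u (x i)) x ∧
      fderiv ℝ (fun x : EuclideanSpace ℝ (Fin 2) => u (x i)) x (EuclideanSpace.single j 1) =
        if i = j then deriv u (x i) else 0 := by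
    intro u hu i j x
    have h := (hu (x i)).hasFDerivAt.comp x (hproj i x)
    refine ⟨h.differentiableAt, ?_⟩
    have h' : fderiv ℝ (fun x : EuclideanSpace ℝ (Fin 2) => u (x i)) x = _ := h.fderiv
    rw [h']
    by_cases hij : i = j <;> simp [hij]
  have h1 : (partialDeriv 1)^[b] (fun x : EuclideanSpace ℝ (Fin 2) => p (x 0) * q (x 1)) =
      fun x => p (x 0) * iteratedDeriv b q (x 1) := by
    induction b with
    | zero => simp
    | succ b ih =>
      rw [Function.iterate_succ_apply', ih]
      funext x
      obtain ⟨d1, e1⟩ := hcomp (hp.differentiable (by simp)) 0 1 x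
      obtain ⟨d2, e2⟩ := hcomp (hit hq b) 1 1 x
      simp only [partialDeriv]
      rw [fderiv_fun_mul d1 d2]
      simp [e1, e2, iteratedDeriv_succ]
  rw [h1]
  induction a with
  | zero => simp
  | succ a ih =>
    rw [Function.iterate_succ_apply', ih]
    funext x
    obtain ⟨d1, e1⟩ := hcomp (hit hp a) 0 0 x
    obtain ⟨d2, e2⟩ := hcomp (hit hq b) 1 0 x
    simp only [partialDeriv]
    rw [fderiv_fun_mul d1 d2]
    simp [e1, e2, iteratedDeriv_succ, mul_comm]

theorem taylorCoeff_tensor {p q : ℝ → ℂ} (hp : ContDiff ℝ ∞ p) (hq : ContDiff ℝ ∞ q)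
    (a b : ℕ) :
    taylorCoeff (fun x : EuclideanSpace ℝ (Fin 2) => p (x 0) * q (x 1)) x a b =
      (iteratedDeriv a p (x 0) / a.factorial) * (iteratedDeriv b q (x 1) / b.factorial) := by
  rw [taylorCoeff, iterate_partialDeriv_tensor hp hq]
  exact mul_div_mul_comm _ _ _ _

theorem contDiff_tensor {p q : ℝ → ℂ} (hp : ContDiff ℝ ∞ p) (hq : ContDiff ℝ ∞ q) :
    ContDiff ℝ ∞ (fun x : EuclideanSpace ℝ (Fin 2) => p (x 0) * q (x 1)) :=
  (hp.comp (EuclideanSpace.proj (𝕜 := ℝ) (0 : Fin 2)).contDiff).mul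
    (hq.comp (EuclideanSpace.proj (𝕜 := ℝ) (1 : Fin 2)).contDiff)

theorem iteratedDeriv_ofReal {u : ℝ → ℝ} (hu : ContDiff ℝ ∞ u) (m : ℕ) :
    iteratedDeriv m (fun t => (u t : ℂ)) = fun t => ((iteratedDeriv m u t : ℝ) : ℂ) := by
  induction m with
  | zero => simp
  | succ m ih =>
    rw [iteratedDeriv_succ, ih]
    funext t
    have h := (hu.differentiable_iteratedDeriv m
      (by exact_mod_cast WithTop.coe_lt_top _) t).hasDerivAt.ofReal_comp
    rw [h.deriv, iteratedDeriv_succ]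

theorem iteratedDeriv_pow_div_factorial (d m : ℕ) (t : ℝ) :
    iteratedDeriv m (fun t : ℝ => (t : ℂ) ^ d) t / m.factorial = (d.choose m : ℂ) * t ^ (d - m) := by
  have h := iteratedDeriv_ofReal (u := fun t => t ^ d) (contDiff_id.pow d) m
  simp only [Complex.ofReal_pow] at h
  rw [h]
  have hm : (m.factorial : ℂ) ≠ 0 := by exact_mod_cast m.factorial_ne_zero
  rw [div_eq_iff hm]
  simp only [iteratedDeriv_pow, Nat.descFactorial_eq_factorial_mul_choose]
  push_cast
  ring

end TaylorCoefficients

theorem StronglyRegular.one_le {M : ℕ → ℝ} (hM : StronglyRegular M) (j : ℕ) : 1 ≤ M j :=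
  hM.zero ▸ hM.mono (Nat.zero_le j)

/-- The ratios `M (i + 1) / M i` increase, so each factor gained on the left is dominated by the one
gained at the later index `i + j`. This makes the class stable under products. -/
theorem StronglyRegular.mul_le {M : ℕ → ℝ} (hM : StronglyRegular M) (i j : ℕ) :
    M i * M j ≤ M (i + j) := by
  induction i with
  | zero => simp [hM.zero]
  | succ i ih =>
    have h1 := hM.logConvex (Nat.le_add_right i j)
    simp only at h1
    have hi := hM.pos i
    have hij := hM.pos (i + j)
    have hs := hM.pos (i + 1)
    have hj := hM.pos j
    have hij' := hM.pos (i + j + 1)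
    calc M (i + 1) * M j = M (i + 1) / M i * (M i * M j) := by field_simp
      _ ≤ M (i + j + 1) / M (i + j) * M (i + j) := by
          gcongr
      _ = M (i + 1 + j) := by rw [div_mul_cancel₀ _ hij.ne']; congr 1; ring

/-! ### Geometric bounds on Taylor coefficients: products, inverses, comparison with derivatives -/

section TaylorBounds

variable {f g : EuclideanSpace ℝ (Fin 2) → ℂ} {x : EuclideanSpace ℝ (Fin 2)} {M : ℕ → ℝ}

/-- The Taylor coefficients of `f` at `x` of order `j` are bounded by `C * σ ^ j * M j`. -/
def HasTaylorBound (M : ℕ → ℝ) (f : EuclideanSpace ℝ (Fin 2) → ℂ) (x : EuclideanSpace ℝ (Fin 2))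
    (C σ : ℝ) : Prop :=
  ∀ a b, ‖taylorCoeff f x a b‖ ≤ C * σ ^ (a + b) * M (a + b)

theorem HasTaylorBound.mono {C D σ τ : ℝ} (h : HasTaylorBound M f x C σ) (hM : ∀ j, 0 ≤ M j)
    (hσ : 0 ≤ σ) (hC : 0 ≤ D) (hCD : C ≤ D) (hστ : σ ≤ τ) : HasTaylorBound M f x D τ :=
  fun a b => (h a b).trans (by have := hM (a + b); gcongr)

theorem HasTaylorBound.congr {C σ : ℝ} (h : HasTaylorBound M f x C σ) (hfg : g =ᶠ[𝓝 x] f) :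
    HasTaylorBound M g x C σ :=
  fun a b => (taylorCoeff_congr hfg a b).symm ▸ h a b

theorem HasTaylorBound.add {C D σ : ℝ} (hf : ContDiffAt ℝ ∞ f x) (hg : ContDiffAt ℝ ∞ g x)
    (h1 : HasTaylorBound M f x C σ) (h2 : HasTaylorBound M g x D σ) :
    HasTaylorBound M (fun y => f y + g y) x (C + D) σ := fun a b => by
  rw [taylorCoeff_add hf hg, add_mul, add_mul]
  exact (norm_add_le _ _).trans (add_le_add (h1 a b) (h2 a b))

/-- The Cauchy product has (a + 1)(b + 1) ≤ 2^(a + b) terms, all with the same bound; their number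
is absorbed by doubling `σ`. -/
theorem HasTaylorBound.mul {C D σ : ℝ} (hf : ContDiffAt ℝ ∞ f x) (hg : ContDiffAt ℝ ∞ g x)
    (hM : ∀ j, 0 ≤ M j) (hMM : ∀ i j, M i * M j ≤ M (i + j)) (hC : 0 ≤ C) (hD : 0 ≤ D)
    (hσ : 0 ≤ σ) (h1 : HasTaylorBound M f x C σ) (h2 : HasTaylorBound M g x D σ) :
    HasTaylorBound M (fun y => f y * g y) x (C * D) (2 * σ) := fun a b => by
  rw [taylorCoeff_mul hf hg]
  have hn := hM (a + b)
  have key : ∀ p ∈ Finset.HasAntidiagonal.antidiagonal a,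
      ∀ q ∈ Finset.HasAntidiagonal.antidiagonal b,
      ‖taylorCoeff f x p.1 q.1 * taylorCoeff g x p.2 q.2‖ ≤ C * D * σ ^ (a + b) * M (a + b) := by
    intro p hp q hq
    obtain rfl := Finset.HasAntidiagonal.mem_antidiagonal.1 hp
    obtain rfl := Finset.HasAntidiagonal.mem_antidiagonal.1 hq
    have e : p.1 + p.2 + (q.1 + q.2) = (p.1 + q.1) + (p.2 + q.2) := by ring
    rw [norm_mul, e]
    have hm1 := hM (p.1 + q.1)
    calc _ ≤ (C * σ ^ (p.1 + q.1) * M (p.1 + q.1)) * (D * σ ^ (p.2 + q.2) * M (p.2 + q.2)) :=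
          mul_le_mul (h1 _ _) (h2 _ _) (norm_nonneg _) (by positivity)
      _ = C * D * σ ^ (p.1 + q.1 + (p.2 + q.2)) * (M (p.1 + q.1) * M (p.2 + q.2)) := by ring
      _ ≤ _ := by gcongr; exact hMM _ _
  have hcount : ∀ m : ℕ, ((m : ℝ) + 1) ≤ 2 ^ m := fun m => by
    exact_mod_cast Nat.succ_le_of_lt (Nat.lt_two_pow_self (n := m))
  calc _ ≤ ∑ p ∈ Finset.HasAntidiagonal.antidiagonal a,
        ((b : ℝ) + 1) * (C * D * σ ^ (a + b) * M (a + b)) := by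
        refine (norm_sum_le _ _).trans (Finset.sum_le_sum fun p hp => ?_)
        refine (norm_sum_le _ _).trans ((Finset.sum_le_card_nsmul _ _ _ (key p hp)).trans ?_)
        simp
    _ = ((a : ℝ) + 1) * (((b : ℝ) + 1) * (C * D * σ ^ (a + b) * M (a + b))) := by simp
    _ ≤ 2 ^ a * (2 ^ b * (C * D * σ ^ (a + b) * M (a + b))) := by
        gcongr <;> exact hcount _
    _ = _ := by rw [mul_pow, pow_add 2 a b]; ring

theorem hasTaylorBound_tensor {p q : ℝ → ℂ} (hp : ContDiff ℝ ∞ p) (hq : ContDiff ℝ ∞ q)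
    {C D σ : ℝ} (hM : ∀ j, 0 ≤ M j) (hMM : ∀ i j, M i * M j ≤ M (i + j)) (hC : 0 ≤ C) (hD : 0 ≤ D)
    (hσ : 0 ≤ σ) (h1 : ∀ m, ‖iteratedDeriv m p (x 0) / m.factorial‖ ≤ C * σ ^ m * M m)
    (h2 : ∀ m, ‖iteratedDeriv m q (x 1) / m.factorial‖ ≤ D * σ ^ m * M m) :
    HasTaylorBound M (fun y => p (y 0) * q (y 1)) x (C * D) σ := fun a b => by
  rw [taylorCoeff_tensor hp hq, norm_mul]
  have ha := hM a
  calc _ ≤ (C * σ ^ a * M a) * (D * σ ^ b * M b) :=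
        mul_le_mul (h1 _) (h2 _) (norm_nonneg _) (by positivity)
    _ = C * D * σ ^ (a + b) * (M a * M b) := by ring
    _ ≤ _ := by gcongr; exact hMM _ _

theorem taylorCoeff_const (c : ℂ) (a b : ℕ) :
    taylorCoeff (fun _ => c) x a b = if a = 0 ∧ b = 0 then c else 0 := by
  have h := taylorCoeff_tensor (x := x) (p := fun _ => c) (q := fun _ => 1) contDiff_const
    contDiff_const a b
  simp only [mul_one, iteratedDeriv_const] at h
  rw [h]
  by_cases ha : a = 0 <;> by_cases hb : b = 0 <;> simp [ha, hb]

theorem sum_antidiagonal_quarter_pow_le (a : ℕ) :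
    ∑ p ∈ Finset.HasAntidiagonal.antidiagonal a, (1 / 4 : ℝ) ^ p.1 ≤ 4 / 3 := by
  rw [Finset.Nat.sum_antidiagonal_eq_sum_range_succ_mk, geom_sum_eq (by norm_num)]
  have : (0 : ℝ) < (1 / 4) ^ a.succ := by positivity
  rw [div_le_iff_of_neg (by norm_num)]
  linarith

/-- Bounds of Cauchy type for the Taylor coefficients of an inverse. -/
theorem HasTaylorBound.of_mul_eq_one (hf : ContDiffAt ℝ ∞ f x) (hg : ContDiffAt ℝ ∞ g x)
    (hfg : ∀ᶠ y in 𝓝 x, f y * g y = 1) {κ : ℝ} (hκ : 0 ≤ κ)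
    (hb : ∀ a b, ‖taylorCoeff f x a b‖ ≤ ‖f x‖ * κ ^ (a + b)) :
    HasTaylorBound (fun _ => 1) g x ‖f x‖⁻¹ (4 * κ) := by
  have hx : f x * g x = 1 := hfg.self_of_nhds
  have hfx : f x ≠ 0 := left_ne_zero_of_mul_eq_one hx
  have hn : 0 < ‖f x‖ := norm_pos_iff.2 hfx
  have main : ∀ n a b, a + b = n → ‖taylorCoeff g x a b‖ ≤ ‖f x‖⁻¹ * (4 * κ) ^ (a + b) := by
    intro n
    induction n using Nat.strong_induction_on with
    | _ n ih =>
    rintro a b rfl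
    by_cases h0 : a = 0 ∧ b = 0
    · obtain ⟨rfl, rfl⟩ := h0
      rw [taylorCoeff_zero_zero, eq_inv_of_mul_eq_one_right hx, norm_inv]
      simp
    have h1 := taylorCoeff_mul hf hg a b
    rw [taylorCoeff_congr (g := fun _ => (1 : ℂ)) hfg, taylorCoeff_const, if_neg h0,
      ← Finset.sum_product'] at h1
    set s := Finset.HasAntidiagonal.antidiagonal a ×ˢ Finset.HasAntidiagonal.antidiagonal b
    have hmem : ((0, a), (0, b)) ∈ s := by
      simp [s]
    rw [← Finset.add_sum_erase s _ hmem] at h1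
    simp only [taylorCoeff_zero_zero] at h1
    -- The Cauchy product for `f * g = 1` is solved for its top term `f x * taylorCoeff g x a b`;
    -- the others involve coefficients of `g` of lower order. Each factor κ^(i+j) available from `f`
    -- is a fraction 4^(-(i+j)) of what the claim allows.
    have h2 : ‖f x‖ * ‖taylorCoeff g x a b‖ ≤
        ∑ r ∈ s.erase ((0, a), (0, b)), (4 * κ) ^ (a + b) * ((1 / 4) ^ r.1.1 * (1 / 4) ^ r.2.1) := by
      rw [← norm_mul, eq_neg_of_add_eq_zero_left h1.symm, norm_neg]
      refine (norm_sum_le _ _).trans (Finset.sum_le_sum fun r hr => ?_)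
      obtain ⟨hne, hrs⟩ := Finset.mem_erase.1 hr
      obtain ⟨⟨i, i'⟩, ⟨j, j'⟩⟩ := r
      simp only [s, Finset.mem_product, Finset.HasAntidiagonal.mem_antidiagonal] at hrs
      obtain ⟨rfl, rfl⟩ := hrs
      have hlt : i' + j' < i + i' + (j + j') := by
        by_contra hcon
        have hi : i = 0 := by omega
        have hj : j = 0 := by omega
        simp [hi, hj] at hne
      rw [norm_mul]
      calc _ ≤ (‖f x‖ * κ ^ (i + j)) * (‖f x‖⁻¹ * (4 * κ) ^ (i' + j')) :=
            mul_le_mul (hb _ _) (ih _ hlt _ _ rfl) (norm_nonneg _) (by positivity)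
        _ = κ ^ (i + j) * (4 * κ) ^ (i' + j') := by field_simp
        _ = _ := by
          have e : i + i' + (j + j') = (i + j) + (i' + j') := by ring
          rw [e, pow_add _ (i + j), mul_pow 4 κ (i + j), ← pow_add (1 / 4 : ℝ) i j, one_div,
            inv_pow]
          field_simp
    -- The full double geometric sum is at most (4/3)² = 16/9, and the erased term is 1, leaving at
    -- most 7/9 ≤ 1. This is what the factor 4 in `4 * κ` is for.
    have h3 : ∑ r ∈ s.erase ((0, a), (0, b)),
        (4 * κ) ^ (a + b) * ((1 / 4 : ℝ) ^ r.1.1 * (1 / 4) ^ r.2.1) ≤ (4 * κ) ^ (a + b) := by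
      rw [← Finset.mul_sum]
      have h4 : ∑ r ∈ s, ((1 / 4 : ℝ) ^ r.1.1 * (1 / 4) ^ r.2.1) ≤ 4 / 3 * (4 / 3) := by
        rw [Finset.sum_product' (f := fun p q : ℕ × ℕ => (1 / 4 : ℝ) ^ p.1 * (1 / 4) ^ q.1),
          ← Finset.sum_mul_sum]
        exact mul_le_mul (sum_antidiagonal_quarter_pow_le a) (sum_antidiagonal_quarter_pow_le b)
          (Finset.sum_nonneg fun _ _ => by positivity) (by norm_num)
      rw [← Finset.add_sum_erase s _ hmem] at h4
      simp only [pow_zero, mul_one] at h4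
      exact mul_le_of_le_one_right (by positivity) (by linarith)
    rw [← div_eq_inv_mul, le_div_iff₀ hn, mul_comm]
    exact h2.trans h3
  intro a b
  rw [mul_one]
  exact main _ a b rfl

theorem HasTaylorBound.norm_multiDeriv_le {C σ : ℝ} (h : HasTaylorBound M f x C σ)
    (J : Fin 2 → ℕ) :
    ‖multiDeriv J f x‖ ≤ C * weight M σ J := by
  have hlen : len J = J 0 + J 1 := by simp [len, Fin.sum_univ_two]
  have hfac : ((J 0).factorial * (J 1).factorial : ℝ) ≤ (len J).factorial := by
    rw [hlen]
    exact_mod_cast Nat.le_of_dvd (Nat.factorial_pos _)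
      (Nat.factorial_mul_factorial_dvd_factorial_add _ _)
  have h1 := h (J 0) (J 1)
  rw [← hlen] at h1
  rw [multiDeriv_eq_taylorCoeff, norm_mul, norm_mul, Complex.norm_natCast, Complex.norm_natCast]
  calc _ ≤ ((len J).factorial : ℝ) * (C * σ ^ len J * M (len J)) := by gcongr
    _ = _ := by unfold weight; ring

/-- Here (a + b)! has to be compared with a! b!; the binomial coefficient is at most 2^(a + b),
which accounts for `2 * σ`. -/
theorem hasTaylorBound_of_norm_multiDeriv_le {C σ : ℝ} (hM : ∀ j, 0 ≤ M j) (hC : 0 ≤ C)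
    (hσ : 0 ≤ σ) (h : ∀ J : Fin 2 → ℕ, ‖multiDeriv J f x‖ ≤ C * weight M σ J) :
    HasTaylorBound M f x C (2 * σ) := fun a b => by
  have h1 := h ![a, b]
  rw [multiDeriv_eq_taylorCoeff, norm_mul, norm_mul, Complex.norm_natCast,
    Complex.norm_natCast] at h1
  have hlen : len ![a, b] = a + b := by simp [len, Fin.sum_univ_two]
  simp only [weight, hlen] at h1
  simp only [Matrix.cons_val_zero, Matrix.cons_val_one] at h1
  have hfac : ((a + b).factorial : ℝ) ≤ 2 ^ (a + b) * (a.factorial * b.factorial) := by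
    have e := Nat.choose_mul_factorial_mul_factorial (Nat.le_add_right a b)
    rw [Nat.add_sub_cancel_left] at e
    have := Nat.choose_le_two_pow (a + b) a
    rw [← e, mul_assoc]
    push_cast
    gcongr
    exact_mod_cast this
  have hpos : (0 : ℝ) < a.factorial * b.factorial := by positivity
  have hMl := hM (a + b)
  refine le_of_mul_le_mul_left (h1.trans ?_) hpos
  calc _ ≤ C * (σ ^ (a + b) * (2 ^ (a + b) * (a.factorial * b.factorial)) * M (a + b)) := by
        gcongr
    _ = _ := by rw [mul_pow]; ring

theorem isClassCM_of_hasTaylorBound (hf : ContDiff ℝ ∞ f)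
    (h : ∀ R : ℝ, 1 ≤ R → ∃ σ : ℝ, 0 < σ ∧ ∃ C : ℝ, 0 < C ∧ ∀ x : EuclideanSpace ℝ (Fin 2),
      (∀ i, |x i| ≤ R) → HasTaylorBound M f x C σ) : IsClassCM M f := by
  refine ⟨hf, fun K hK => ?_⟩
  obtain ⟨R, hR⟩ := hK.isBounded.exists_norm_le
  obtain ⟨σ, hσ, C, hC, hb⟩ := h (max R 1) (le_max_right _ _)
  refine ⟨σ, hσ, C, hC, fun J x hx => ?_⟩
  exact (hb x fun i => (PiLp.norm_apply_le x i).trans ((hR x hx).trans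
    (le_max_left _ _))).norm_multiDeriv_le J

end TaylorBounds

/-! ### The factor x₁² + x₂^(2k) and its inverse -/

section Example

theorem contDiff_ofReal_pow (d : ℕ) : ContDiff ℝ ∞ (fun t : ℝ => (t : ℂ) ^ d) :=
  Complex.ofRealCLM.contDiff.pow d

theorem norm_iteratedDeriv_pow_div_le {M : ℕ → ℝ} (hM : StronglyRegular M) {R t : ℝ} (hR : 1 ≤ R)
    (ht : |t| ≤ R) (d m : ℕ) :
    ‖iteratedDeriv m (fun t : ℝ => (t : ℂ) ^ d) t / m.factorial‖ ≤ (2 ^ d * R ^ d) * 1 ^ m * M m := by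
  rw [iteratedDeriv_pow_div_factorial, norm_mul, norm_pow, Complex.norm_natCast, Complex.norm_real,
    Real.norm_eq_abs, one_pow, mul_one]
  refine le_trans ?_ (le_mul_of_one_le_right (by positivity) (hM.one_le m))
  gcongr
  · exact_mod_cast Nat.choose_le_two_pow d m
  · exact (pow_le_pow_left₀ (abs_nonneg _) ht _).trans (pow_le_pow_right₀ hR (Nat.sub_le _ _))

theorem hasTaylorBound_monomial {M : ℕ → ℝ} (hM : StronglyRegular M) {R : ℝ} (hR : 1 ≤ R)
    {x : EuclideanSpace ℝ (Fin 2)} (hx : ∀ i, |x i| ≤ R) (d e : ℕ) :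
    HasTaylorBound M (fun y => (y 0 : ℂ) ^ d * (y 1 : ℂ) ^ e) x
      ((2 ^ d * R ^ d) * (2 ^ e * R ^ e)) 1 :=
  hasTaylorBound_tensor (contDiff_ofReal_pow d) (contDiff_ofReal_pow e) (fun j => (hM.pos j).le)
    hM.mul_le (by positivity) (by positivity) zero_le_one
    (norm_iteratedDeriv_pow_div_le hM hR (hx 0) d) (norm_iteratedDeriv_pow_div_le hM hR (hx 1) e)

theorem isClassCM_exampleFun {M : ℕ → ℝ} (hM : StronglyRegular M) (k : ℕ) :
    IsClassCM M (exampleFun k) := by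
  have he : exampleFun k =
      fun y => (y 0 : ℂ) ^ 3 * (y 1 : ℂ) ^ 0 + (y 0 : ℂ) ^ 1 * (y 1 : ℂ) ^ (2 * k) := by
    funext y
    simp only [exampleFun]
    push_cast
    ring
  have hs : ∀ d e : ℕ, ContDiff ℝ ∞
      (fun y : EuclideanSpace ℝ (Fin 2) => (y 0 : ℂ) ^ d * (y 1 : ℂ) ^ e) := fun d e =>
    contDiff_tensor (contDiff_ofReal_pow d) (contDiff_ofReal_pow e)
  rw [he]
  refine isClassCM_of_hasTaylorBound ((hs 3 0).add (hs 1 (2 * k))) fun R hR => ?_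
  refine ⟨1, one_pos, _, ?_, fun x hx => HasTaylorBound.add (hs 3 0).contDiffAt
    (hs 1 (2 * k)).contDiffAt (hasTaylorBound_monomial hM hR hx 3 0)
    (hasTaylorBound_monomial hM hR hx 1 (2 * k))⟩
  positivity

/-- The second factor `x₁ ^ 2 + x₂ ^ (2k)` of the example. -/
noncomputable def secondFactor (k : ℕ) : EuclideanSpace ℝ (Fin 2) → ℂ :=
  fun y => (y 0 : ℂ) ^ 2 * (y 1 : ℂ) ^ 0 + (y 0 : ℂ) ^ 0 * (y 1 : ℂ) ^ (2 * k)

theorem secondFactor_eq (k : ℕ) (x : EuclideanSpace ℝ (Fin 2)) :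
    secondFactor k x = ((x 0 ^ 2 + x 1 ^ (2 * k) : ℝ) : ℂ) := by
  simp [secondFactor]

theorem exampleFun_eq (k : ℕ) (x : EuclideanSpace ℝ (Fin 2)) :
    exampleFun k x = (x 0 : ℂ) * secondFactor k x := by
  rw [secondFactor_eq, exampleFun, Complex.ofReal_mul]

theorem contDiff_secondFactor (k : ℕ) : ContDiff ℝ ∞ (secondFactor k) :=
  (contDiff_tensor (contDiff_ofReal_pow 2) (contDiff_ofReal_pow 0)).add
    (contDiff_tensor (contDiff_ofReal_pow 0) (contDiff_ofReal_pow (2 * k)))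

theorem taylorCoeff_secondFactor (k : ℕ) (x : EuclideanSpace ℝ (Fin 2)) (a b : ℕ) :
    taylorCoeff (secondFactor k) x a b =
      (if b = 0 then (Nat.choose 2 a : ℂ) * (x 0 : ℂ) ^ (2 - a) else 0) +
        if a = 0 then ((2 * k).choose b : ℂ) * (x 1 : ℂ) ^ (2 * k - b) else 0 := by
  have h0 : ∀ (m : ℕ) (c : ℂ), ((Nat.choose 0 m : ℕ) : ℂ) * c ^ (0 - m) = if m = 0 then 1 else 0 := by
    intro m c
    cases m <;> simp
  unfold secondFactor
  rw [taylorCoeff_add (contDiff_tensor (contDiff_ofReal_pow 2) (contDiff_ofReal_pow 0)).contDiffAt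
    (contDiff_tensor (contDiff_ofReal_pow 0) (contDiff_ofReal_pow (2 * k))).contDiffAt,
    taylorCoeff_tensor (contDiff_ofReal_pow 2) (contDiff_ofReal_pow 0),
    taylorCoeff_tensor (contDiff_ofReal_pow 0) (contDiff_ofReal_pow (2 * k))]
  simp only [iteratedDeriv_pow_div_factorial, h0]
  split_ifs <;> simp

/-- The natural scale at x is s = √ψ(x): since |x₁| ≤ s and |x₂|^k ≤ s, a differentiation costs at
most a constant times 1/s relative to ψ(x) = s², uniformly on the square of half-side `R`. -/
theorem norm_taylorCoeff_secondFactor_le (k : ℕ) (hk : 1 ≤ k) {R : ℝ} (hR : 1 ≤ R) :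
    ∃ κ : ℝ, 1 ≤ κ ∧ ∀ x : EuclideanSpace ℝ (Fin 2), (∀ i, |x i| ≤ R) →
      ∀ s : ℝ, 0 < s → s ^ 2 = x 0 ^ 2 + x 1 ^ (2 * k) → ∀ a b,
        ‖taylorCoeff (secondFactor k) x a b‖ ≤ ‖secondFactor k x‖ * (κ / s) ^ (a + b) := by
  have hRk : 1 ≤ R ^ (2 * k) := one_le_pow₀ hR
  set Q : ℝ := 2 * R ^ (2 * k) with hQ
  have hQ1 : 1 ≤ Q := by linarith
  have h4 : (1 : ℝ) ≤ 4 ^ k := one_le_pow₀ (by norm_num)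
  -- `4 ^ k` bounds the binomial coefficients of order 2k, `Q` bounds both s and the powers of |x₂|
  -- up to 2k, and 2 is the middle binomial coefficient of x₁².
  refine ⟨2 * (4 ^ k * Q), by nlinarith, fun x hx s hs hs2 a b => ?_⟩
  set κ := 2 * (4 ^ k * Q) with hκ
  have hκ1 : 2 ≤ κ := by nlinarith
  have hψ : ‖secondFactor k x‖ = s ^ 2 := by
    rw [secondFactor_eq, ← hs2, Complex.norm_real, Real.norm_eq_abs, abs_of_pos (by positivity)]
  rw [hψ]
  have hy2 : |x 1| ^ (2 * k) = x 1 ^ (2 * k) := (even_two_mul k).pow_abs _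
  have hx0 : |x 0| ≤ s := abs_le_of_sq_le_sq (by
    have := (even_two_mul k).pow_nonneg (x 1); linarith) hs.le
  have hx1 : |x 1| ^ k ≤ s := by
    refine le_of_sq_le_sq ?_ hs.le
    rw [hs2, ← pow_mul, mul_comm k 2, hy2]
    have := sq_nonneg (x 0)
    linarith
  have hsQ : s ≤ Q := by
    refine le_of_sq_le_sq ?_ (by linarith)
    rw [hs2, ← hy2]
    have e1 : x 0 ^ 2 ≤ R ^ (2 * k) := by
      rw [← sq_abs]
      exact (pow_le_pow_left₀ (abs_nonneg _) (hx 0) 2).trans (pow_le_pow_right₀ hR (by omega))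
    have e2 : |x 1| ^ (2 * k) ≤ R ^ (2 * k) := pow_le_pow_left₀ (abs_nonneg _) (hx 1) _
    nlinarith
  rw [taylorCoeff_secondFactor]
  rcases Nat.eq_zero_or_pos b with rfl | hb
  · rcases Nat.eq_zero_or_pos a with rfl | ha
    · have := hψ
      rw [secondFactor] at this
      simp only [pow_zero, mul_one, one_mul] at this
      simpa using this.le
    · rw [if_pos rfl, if_neg ha.ne', add_zero, norm_mul, norm_pow, Complex.norm_natCast,
        Complex.norm_real, Real.norm_eq_abs, add_zero]
      obtain rfl | rfl | h3 : a = 1 ∨ a = 2 ∨ 2 < a := by omega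
      · simp only [Nat.choose_one_right, Nat.cast_ofNat, pow_one]
        calc 2 * |x 0| ^ (2 - 1) ≤ κ * s := by simp only [Nat.add_one_sub_one, pow_one]; gcongr
          _ = _ := by field_simp
      · have : s ^ 2 * (κ / s) ^ 2 = κ ^ 2 := by field_simp
        rw [this]
        simp only [Nat.choose_self, Nat.cast_one, tsub_self, pow_zero, mul_one]
        nlinarith
      · rw [Nat.choose_eq_zero_of_lt h3]
        simp only [Nat.cast_zero, zero_mul]
        positivity
  · rw [if_neg hb.ne', zero_add]
    split_ifs with ha
    · subst ha
      rw [norm_mul, norm_pow, Complex.norm_natCast, Complex.norm_real, Real.norm_eq_abs, zero_add]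
      have hc : ((2 * k).choose b : ℝ) ≤ 4 ^ k := by
        have := Nat.choose_le_two_pow (2 * k) b
        rw [pow_mul] at this
        exact_mod_cast this
      have hR0 : 0 ≤ R := by linarith
      have hyR : ∀ m ≤ 2 * k, |x 1| ^ m ≤ Q := fun m hm => by
        have := (pow_le_pow_left₀ (abs_nonneg _) (hx 1) m).trans (pow_le_pow_right₀ hR hm)
        linarith
      -- For b ≥ 2 the factor s² is already present in s^b. For b = 1 the missing s comes from
      -- |x₂|^(2k-1) = |x₂|^(k-1) |x₂|^k with |x₂|^k ≤ s.
      have hmain : |x 1| ^ (2 * k - b) * s ^ b ≤ Q ^ b * s ^ 2 := by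
        obtain rfl | ⟨c, rfl⟩ : b = 1 ∨ ∃ c, b = c + 2 := by
          rcases b with _ | _ | c
          · omega
          · exact Or.inl rfl
          · exact Or.inr ⟨c, rfl⟩
        · have e : 2 * k - 1 = (k - 1) + k := by omega
          rw [e, pow_add, pow_one, pow_one, sq, mul_assoc]
          exact mul_le_mul (hyR _ (by omega)) (mul_le_mul_of_nonneg_right hx1 hs.le)
            (by positivity) (by linarith)
        · rw [pow_add s, ← mul_assoc]
          gcongr
          calc _ ≤ Q * Q ^ c := mul_le_mul (hyR _ (Nat.sub_le _ _))
                (pow_le_pow_left₀ hs.le hsQ c) (by positivity) (by linarith)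
            _ = Q ^ (c + 1) := by ring
            _ ≤ Q ^ (c + 2) := pow_le_pow_right₀ hQ1 (by omega)
      have hsb : 0 < s ^ b := by positivity
      rw [div_pow, ← mul_div_assoc, le_div_iff₀ hsb]
      calc _ = ((2 * k).choose b : ℝ) * (|x 1| ^ (2 * k - b) * s ^ b) := by ring
        _ ≤ 4 ^ k * (Q ^ b * s ^ 2) := by gcongr
        _ ≤ (4 ^ k) ^ b * (Q ^ b * s ^ 2) := by
            gcongr
            exact le_self_pow₀ h4 hb.ne'
        _ = (4 ^ k * Q) ^ b * s ^ 2 := by rw [mul_pow]; ring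
        _ ≤ κ ^ b * s ^ 2 := by
            gcongr
            rw [hκ]
            nlinarith
        _ = _ := by ring
    · rw [norm_zero]
      positivity

theorem hasTaylorBound_inv_secondFactor (k : ℕ) (hk : 1 ≤ k) {R : ℝ} (hR : 1 ≤ R) :
    ∃ κ : ℝ, 1 ≤ κ ∧ ∀ x : EuclideanSpace ℝ (Fin 2), (∀ i, |x i| ≤ R) →
      ∀ s : ℝ, 0 < s → s ^ 2 = x 0 ^ 2 + x 1 ^ (2 * k) →
        ContDiffAt ℝ ∞ (fun y => (secondFactor k y)⁻¹) x ∧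
          HasTaylorBound (fun _ => 1) (fun y => (secondFactor k y)⁻¹) x (s ^ 2)⁻¹ (κ / s) := by
  obtain ⟨κ, hκ, h⟩ := norm_taylorCoeff_secondFactor_le k hk hR
  refine ⟨4 * κ, by linarith, fun x hx s hs hs2 => ?_⟩
  have hval : secondFactor k x = ((s ^ 2 : ℝ) : ℂ) := by rw [secondFactor_eq, hs2]
  have hne : secondFactor k x ≠ 0 := by
    rw [hval]
    exact_mod_cast (pow_pos hs 2).ne'
  have hsm := (contDiff_secondFactor k).contDiffAt (x := x)
  have hn : ‖secondFactor k x‖ = s ^ 2 := by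
    rw [hval, Complex.norm_real, Real.norm_eq_abs, abs_of_pos (by positivity)]
  have hev : ∀ᶠ y in 𝓝 x, secondFactor k y * (secondFactor k y)⁻¹ = 1 := by
    filter_upwards [hsm.continuousAt.eventually_ne hne] with y hy
    exact mul_inv_cancel₀ hy
  have hb := HasTaylorBound.of_mul_eq_one hsm (hsm.inv hne) hev (by positivity) (h x hx s hs hs2)
  rw [hn, ← mul_div_assoc] at hb
  exact ⟨hsm.inv hne, hb⟩

end Example

/-! ### Growth of strongly regular sequences and stability under square roots -/

namespace StronglyRegular

variable {M : ℕ → ℝ}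

theorem one_le_ratio (hM : StronglyRegular M) (j : ℕ) : 1 ≤ M (j + 1) / M j :=
  (one_le_div (hM.pos j)).2 (hM.mono (Nat.le_succ j))

/-- If the increasing ratios stayed below `B`, the series in the strong non-quasianalyticity
condition would dominate the harmonic series divided by `B`. -/
theorem tendsto_ratio (hM : StronglyRegular M) :
    Filter.Tendsto (fun j => M (j + 1) / M j) Filter.atTop Filter.atTop := by
  refine Filter.tendsto_atTop_atTop_of_monotone hM.logConvex fun B => ?_
  by_contra! hB
  obtain ⟨A, -, hA⟩ := hM.strongNonQuasianalytic
  have hs := (hA 0).1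
  simp only [zero_add] at hs
  have hB0 : 0 < B := one_pos.trans_le ((hM.one_le_ratio 0).trans (hB 0).le)
  have h1 : Summable fun j : ℕ => B⁻¹ * (1 / ((j + 1 : ℕ) : ℝ)) := by
    refine Summable.of_nonneg_of_le (fun j => by positivity) (fun j => ?_) hs
    have h2 := hB j
    have hj := hM.pos j
    have hj' := hM.pos (j + 1)
    rw [div_lt_iff₀ hj] at h2
    rw [inv_mul_eq_div, div_div, div_le_div_iff₀ (by positivity) (by positivity)]
    push_cast
    nlinarith [mul_le_mul_of_nonneg_left h2.le (by positivity : (0 : ℝ) ≤ (j : ℝ) + 1)]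
  exact Real.not_summable_one_div_natCast
    ((summable_nat_add_iff 1).1 ((summable_mul_left_iff (inv_ne_zero hB0.ne')).1 h1))

/-- Once the ratios exceed 2/δ the terms at least double. Consequently the infimum defining h_M is
attained and positive. -/
theorem tendsto_pow_mul (hM : StronglyRegular M) {δ : ℝ} (hδ : 0 < δ) :
    Filter.Tendsto (fun j => δ ^ j * M j) Filter.atTop Filter.atTop := by
  obtain ⟨N, hN⟩ := Filter.eventually_atTop.1 (hM.tendsto_ratio.eventually_ge_atTop (2 / δ))
  rw [← Filter.tendsto_add_atTop_iff_nat N]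
  refine tendsto_atTop_of_geom_le (mul_pos (by positivity) (hM.pos _)) one_lt_two fun j => ?_
  have h := hN (j + N) (Nat.le_add_left _ _)
  have hp := hM.pos (j + N)
  rw [le_div_iff₀ hp, div_mul_eq_mul_div, div_le_iff₀ hδ] at h
  have e : j + 1 + N = j + N + 1 := by ring
  rw [e, pow_succ]
  have := mul_le_mul_of_nonneg_left h (pow_pos hδ (j + N)).le
  linarith

theorem exists_forall_pow_mul_le (hM : StronglyRegular M) {δ : ℝ} (hδ : 0 < δ) :
    ∃ i, ∀ j, δ ^ i * M i ≤ δ ^ j * M j := by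
  have := hM.tendsto_pow_mul hδ
  rw [← Nat.cofinite_eq_atTop] at this
  exact this.exists_forall_le

theorem hFun_pos (hM : StronglyRegular M) {t : ℝ} (ht : 0 < t) : 0 < hFun M t := by
  obtain ⟨i, hi⟩ := hM.exists_forall_pow_mul_le ht
  rw [hFun, if_pos ht]
  exact (mul_pos (pow_pos ht i) (hM.pos i)).trans_le (le_ciInf hi)

theorem hFun_le (hM : StronglyRegular M) {t : ℝ} (ht : 0 < t) (j : ℕ) :
    hFun M t ≤ t ^ j * M j := by
  rw [hFun, if_pos ht]
  refine ciInf_le ⟨0, ?_⟩ j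
  rintro _ ⟨i, rfl⟩
  exact mul_nonneg (pow_nonneg ht.le i) (hM.pos i).le

theorem le_ratio_pow (hM : StronglyRegular M) (i : ℕ) : M i ≤ (M (i + 1) / M i) ^ i := by
  induction i with
  | zero => simp [hM.zero]
  | succ i ih =>
    have h := hM.logConvex (Nat.le_succ i)
    simp only [Nat.succ_eq_add_one] at h
    have h1 : 0 ≤ M (i + 1) / M i := (div_pos (hM.pos _) (hM.pos _)).le
    calc M (i + 1) = M i * (M (i + 1) / M i) := (mul_div_cancel₀ _ (hM.pos i).ne').symm
      _ ≤ (M (i + 1) / M i) ^ i * (M (i + 1) / M i) := by gcongr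
      _ = (M (i + 1) / M i) ^ (i + 1) := (pow_succ _ _).symm
      _ ≤ _ := pow_le_pow_left₀ h1 h _

theorem mul_ratio_pow_le (hM : StronglyRegular M) (i d : ℕ) :
    M i * (M (i + 1) / M i) ^ d ≤ M (i + d) := by
  induction d with
  | zero => simp
  | succ d ih =>
    have h := hM.logConvex (Nat.le_add_right i d)
    simp only at h
    have h1 : 0 ≤ M (i + 1) / M i := (div_pos (hM.pos _) (hM.pos _)).le
    have h2 := hM.pos (i + d)
    calc M i * (M (i + 1) / M i) ^ (d + 1) =
          M i * (M (i + 1) / M i) ^ d * (M (i + 1) / M i) := by ring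
      _ ≤ M (i + d) * (M (i + d + 1) / M (i + d)) := by gcongr
      _ = _ := mul_div_cancel₀ _ h2.ne'

/-- This is the monotonicity of M_i^(1/i), with roots cleared. With r = M_(i+1)/M_i, the number M_i
is a product of i ratios at most r, while the d ratios leading from M_i to M_(i+d) are at least r.
-/
theorem pow_le_pow (hM : StronglyRegular M) {i j : ℕ} (hij : i ≤ j) : M i ^ j ≤ M j ^ i := by
  obtain ⟨d, rfl⟩ := Nat.exists_eq_add_of_le hij
  have h0 := hM.pos i
  calc M i ^ (i + d) = M i ^ i * M i ^ d := pow_add _ _ _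
    _ ≤ M i ^ i * ((M (i + 1) / M i) ^ i) ^ d := by
        gcongr
        exact hM.le_ratio_pow i
    _ = (M i * (M (i + 1) / M i) ^ d) ^ i := by rw [mul_pow, ← pow_mul, ← pow_mul, mul_comm i d]
    _ ≤ _ := by
        have := div_pos (hM.pos (i + 1)) h0
        exact pow_le_pow_left₀ (by positivity) (hM.mul_ratio_pow_le i d) i

/-- From M_i^(1/i) ≤ M_j^(1/j) and M_j ≥ 1. It lets M at an index up to 3j/4 be bounded by
M_j^(3/4), the power that appears in the height of the pulses. -/
theorem pow_four_le_pow_three (hM : StronglyRegular M) {i j : ℕ} (hij : 4 * i ≤ 3 * j) :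
    M i ^ 4 ≤ M j ^ 3 := by
  rcases Nat.eq_zero_or_pos j with rfl | hj
  · obtain rfl : i = 0 := by omega
    simp [hM.zero]
  have h0 := hM.pos i
  have h1 := hM.pos j
  rw [← pow_le_pow_iff_left₀ (by positivity) (by positivity) hj.ne', ← pow_mul, ← pow_mul]
  calc M i ^ (4 * j) = (M i ^ j) ^ 4 := by rw [← pow_mul, mul_comm]
    _ ≤ (M j ^ i) ^ 4 := by
        gcongr
        exact hM.pow_le_pow (by omega)
    _ = M j ^ (4 * i) := by rw [← pow_mul, mul_comm]
    _ ≤ _ := pow_le_pow_right₀ (hM.one_le j) hij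

/-- Square roots of strongly regular sequences are strongly regular. -/
theorem sqrt (hM : StronglyRegular M) : StronglyRegular fun j => √(M j) where
  zero := by simp [hM.zero]
  mono := fun i j h => Real.sqrt_le_sqrt (hM.mono h)
  logConvex := fun i j h => by
    simp only [← Real.sqrt_div (hM.pos _).le]
    exact Real.sqrt_le_sqrt (hM.logConvex h)
  moderateGrowth := by
    obtain ⟨A, hA, h⟩ := hM.moderateGrowth
    refine ⟨√A, Real.sqrt_pos.2 hA, fun j k => ?_⟩
    have hj := hM.pos j
    refine (Real.sqrt_le_sqrt (h j k)).trans_eq ?_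
    have e : √(A ^ (j + k)) = √A ^ (j + k) := by
      rw [Real.sqrt_eq_iff_eq_sq (by positivity) (by positivity), ← pow_mul, mul_comm, pow_mul,
        Real.sq_sqrt hA.le]
    rw [Real.sqrt_mul (by positivity), Real.sqrt_mul (by positivity), e]
  strongNonQuasianalytic := by
    obtain ⟨A, hA, h⟩ := hM.strongNonQuasianalytic
    set a : ℕ → ℝ := fun j => M j / ((j + 1 : ℝ) * M (j + 1)) with ha
    have hapos : ∀ j, 0 < a j := fun j => by
      have := hM.pos j
      have := hM.pos (j + 1)
      simp only [ha]
      positivity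
    set R : ℕ → ℝ := fun k => ∑' j, a (k + j) with hR
    have hsum : ∀ k, Summable fun j => a (k + j) := fun k => (h k).1
    have hRle : ∀ k, R k ≤ A * (M k / M (k + 1)) := fun k => (h k).2
    have hRsucc : ∀ k, R k = a k + R (k + 1) := fun k => by
      simp only [hR]
      rw [(hsum k).tsum_eq_zero_add]
      simp only [add_zero, add_assoc, add_comm 1]
    have hRpos : ∀ k, 0 < R k := fun k => (hsum k).tsum_pos (fun j => (hapos _).le) 0 (hapos _)
    -- `R` denotes the tails, so a_j = R_j − R_(j+1) factors as a difference of squares. The left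
    -- side equals a_j √(M_(j+1)/M_j), at most √A a_j/√R_j by the tail bound, and a_j/√R_j ≤ 2(√R_j
    -- − √R_(j+1)): the series becomes telescoping.
    have key : ∀ j, √(M j) / ((j + 1 : ℝ) * √(M (j + 1))) ≤ 2 * √A * (√(R j) - √(R (j + 1))) := by
      intro j
      have hj := hM.pos j
      have hj' := hM.pos (j + 1)
      have hs := Real.sqrt_pos.2 (hRpos j)
      have hs' := Real.sqrt_pos.2 (hRpos (j + 1))
      have e0 : 0 < √(M j) := Real.sqrt_pos.2 hj
      have e0' : 0 < √(M (j + 1)) := Real.sqrt_pos.2 hj'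
      have e1 : √(M j) / ((j + 1 : ℝ) * √(M (j + 1))) = a j * (√(M (j + 1)) / √(M j)) := by
        have s1 := Real.sq_sqrt hj.le
        have s2 := Real.sq_sqrt hj'.le
        simp only [ha]
        rw [← s1, ← s2, Real.sqrt_sq e0.le, Real.sqrt_sq e0'.le]
        field_simp
      have e2 : √(M (j + 1)) / √(M j) * √(R j) ≤ √A := by
        rw [← Real.sqrt_div hj'.le, ← Real.sqrt_mul (by positivity)]
        refine Real.sqrt_le_sqrt ?_
        have := mul_le_mul_of_nonneg_left (hRle j) (div_pos hj' hj).le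
        refine this.trans_eq ?_
        field_simp
      have e3 : a j = (√(R j) - √(R (j + 1))) * (√(R j) + √(R (j + 1))) := by
        have s1 := Real.sq_sqrt (hRpos j).le
        have s2 := Real.sq_sqrt (hRpos (j + 1)).le
        have s3 := hRsucc j
        linear_combination -s1 + s2 - s3
      have e4 : √(R (j + 1)) ≤ √(R j) := Real.sqrt_le_sqrt (by
        have := hRsucc j
        have := hapos j
        linarith)
      refine le_of_mul_le_mul_right ?_ hs
      calc _ = a j * (√(M (j + 1)) / √(M j) * √(R j)) := by rw [e1, mul_assoc]
        _ ≤ a j * √A := mul_le_mul_of_nonneg_left e2 (hapos j).le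
        _ = √A * ((√(R j) - √(R (j + 1))) * (√(R j) + √(R (j + 1)))) := by rw [e3]; ring
        _ ≤ √A * ((√(R j) - √(R (j + 1))) * (√(R j) + √(R j))) := by
            have : 0 ≤ √(R j) - √(R (j + 1)) := by linarith
            gcongr
        _ = _ := by ring
    refine ⟨2 * A, by positivity, fun k => ?_⟩
    set b : ℕ → ℝ := fun j => √(M (k + j)) / (((k + j : ℕ) + 1 : ℝ) * √(M (k + j + 1)))
    have hb0 : ∀ j, 0 ≤ b j := fun j => by positivity
    have hpart : ∀ n, ∑ j ∈ Finset.range n, b j ≤ 2 * A * (√(M k) / √(M (k + 1))) := by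
      intro n
      have hk := hM.pos k
      calc ∑ j ∈ Finset.range n, b j
          ≤ ∑ j ∈ Finset.range n, 2 * √A * (√(R (k + j)) - √(R (k + (j + 1)))) :=
            Finset.sum_le_sum fun j _ => key (k + j)
        _ = 2 * √A * (√(R k) - √(R (k + n))) := by
            rw [← Finset.mul_sum, Finset.sum_range_sub' (fun j => √(R (k + j)))]
            simp
        _ ≤ 2 * √A * √(A * (M k / M (k + 1))) := by
            gcongr
            have := Real.sqrt_nonneg (R (k + n))
            have := Real.sqrt_le_sqrt (hRle k)
            linarith
        _ = _ := by
            rw [Real.sqrt_mul hA.le, Real.sqrt_div hk.le]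
            linear_combination 2 * (√(M k) / √(M (k + 1))) * Real.mul_self_sqrt hA.le
    exact ⟨summable_of_sum_range_le hb0 hpart, Real.tsum_le_of_sum_range_le hb0 hpart⟩

end StronglyRegular

/-! ### Averages over symmetric intervals -/

section Averages

/-- The average of `u` over the interval `[x - a, x + a]`. -/
noncomputable def average (a : ℝ) (u : ℝ → ℝ) (x : ℝ) : ℝ :=
  (1 / 2) * ∫ s in (-1 : ℝ)..1, u (x + a * s)

variable {a : ℝ} {u w : ℝ → ℝ}

theorem intervalIntegrable_average (hu : Continuous u) (a x : ℝ) :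
    IntervalIntegrable (fun s => u (x + a * s)) MeasureTheory.volume (-1) 1 :=
  Continuous.intervalIntegrable (by fun_prop) _ _

/-- One comparison serves several purposes: with u = w it preserves Lipschitz bounds, with w
constant it gives size and displacement bounds, and with x = y it shows that averaging is a
contraction for the uniform distance. -/
theorem abs_average_sub_le (hu : Continuous u) (hw : Continuous w) {x y C : ℝ}
    (h : ∀ s ∈ Set.Icc (-1 : ℝ) 1, |u (x + a * s) - w (y + a * s)| ≤ C) :
    |average a u x - average a w y| ≤ C := by
  rw [average, average, ← mul_sub, ← intervalIntegral.integral_sub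
    (intervalIntegrable_average hu a x) (intervalIntegrable_average hw a y), abs_mul]
  have h1 := intervalIntegral.norm_integral_le_of_norm_le_const (a := (-1 : ℝ)) (b := 1)
    (f := fun s => u (x + a * s) - w (y + a * s)) (C := C) (fun s hs => by
      rw [Set.uIoc_of_le (by norm_num)] at hs
      exact h s ⟨hs.1.le, hs.2⟩)
  rw [Real.norm_eq_abs] at h1
  norm_num at h1 ⊢
  linarith

theorem average_const (a c x : ℝ) : average a (fun _ => c) x = c := by
  simp [average]
  ring

theorem average_nonneg (hu : ∀ x, 0 ≤ u x) (a x : ℝ) : 0 ≤ average a u x :=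
  mul_nonneg (by norm_num) (intervalIntegral.integral_nonneg (by norm_num) fun _ _ => hu _)

theorem average_eq_zero {r x : ℝ} (ha : 0 ≤ a) (hu : ∀ x, r ≤ |x| → u x = 0) (hx : r + a ≤ |x|) :
    average a u x = 0 := by
  have : Set.EqOn (fun s => u (x + a * s)) (fun _ => 0) (Set.uIcc (-1) 1) := fun s hs => by
    rw [Set.uIcc_of_le (by norm_num)] at hs
    refine hu _ ?_
    have h1 : |a * s| ≤ a := by
      rw [abs_mul, abs_of_nonneg ha]
      exact mul_le_of_le_one_right ha (abs_le.2 hs)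
    have h2 := abs_sub_abs_le_abs_sub x (-(a * s))
    rw [abs_neg, sub_neg_eq_add] at h2
    linarith
  rw [average, intervalIntegral.integral_congr this]
  simp

/-- The average is a difference quotient of a primitive of u, so each averaging buys one derivative
at the price of a factor 1/a. -/
theorem hasDerivAt_average (ha : 0 < a) (hu : Continuous u) (x : ℝ) :
    HasDerivAt (average a u) ((u (x + a) - u (x - a)) / (2 * a)) x := by
  have h1 : average a u = fun y => (2 * a)⁻¹ * ((∫ s in (0 : ℝ)..(y + a), u s) -
      ∫ s in (0 : ℝ)..(y - a), u s) := by
    funext y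
    rw [average, intervalIntegral.integral_comp_add_mul (fun s => u s) ha.ne',
      intervalIntegral.integral_interval_sub_left (hu.intervalIntegrable _ _)
        (hu.intervalIntegrable _ _)]
    simp only [smul_eq_mul, mul_neg, mul_one, ← sub_eq_add_neg]
    field_simp
  have hF : ∀ y, HasDerivAt (fun z => ∫ s in (0 : ℝ)..z, u s) (u y) y := fun y =>
    hu.integral_hasStrictDerivAt 0 y |>.hasDerivAt
  rw [h1]
  have h2 := (((hF (x + a)).comp_add_const x a).sub ((hF (x - a)).comp_sub_const x a)).const_mul
    (2 * a)⁻¹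
  rwa [← div_eq_inv_mul] at h2

end Averages

/-! ### Smooth bump functions as limits of repeated averages of a tent -/

section InfiniteAverage

/-- The tent function. -/
noncomputable def tent (x : ℝ) : ℝ := max 0 (1 - 2 * |x|)

theorem tent_lipschitz (x y : ℝ) : |tent x - tent y| ≤ 2 * |x - y| := by
  refine (abs_max_sub_max_le_max _ _ _ _).trans (max_le (by simp) ?_)
  have h := abs_abs_sub_abs_le y x
  rw [abs_sub_comm y x] at h
  calc _ = |2 * (|y| - |x|)| := by congr 1; ring
    _ = 2 * |(|y| - |x|)| := by rw [abs_mul, abs_two]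
    _ ≤ _ := by linarith

/-- The successive averages of the tent function over intervals of half-lengths
`a (j + n - 1), …, a j`. -/
noncomputable def iteratedAverage (a : ℕ → ℝ) : ℕ → ℕ → ℝ → ℝ
  | 0, _ => tent
  | n + 1, j => average (a j) (iteratedAverage a n (j + 1))

theorem continuous_of_lipschitz_two {u : ℝ → ℝ} (h : ∀ x y, |u x - u y| ≤ 2 * |x - y|) :
    Continuous u :=
  (LipschitzWith.of_dist_le_mul (K := 2) fun x y => by simpa [Real.dist_eq] using h x y).continuous

variable {a : ℕ → ℝ}

theorem iteratedAverage_lipschitz (n j : ℕ) (x y : ℝ) :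
    |iteratedAverage a n j x - iteratedAverage a n j y| ≤ 2 * |x - y| := by
  induction n generalizing j x y with
  | zero => exact tent_lipschitz x y
  | succ n ih =>
    have hc := continuous_of_lipschitz_two (ih (j + 1))
    refine abs_average_sub_le hc hc fun s _ => (ih _ _ _).trans_eq ?_
    congr 2
    ring

theorem iteratedAverage_continuous (n j : ℕ) : Continuous (iteratedAverage a n j) :=
  continuous_of_lipschitz_two (iteratedAverage_lipschitz n j)

theorem iteratedAverage_nonneg (n j : ℕ) (x : ℝ) : 0 ≤ iteratedAverage a n j x := by
  induction n generalizing j x with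
  | zero => exact le_max_left _ _
  | succ n ih => exact average_nonneg (ih _) _ _

theorem abs_iteratedAverage_le_one (n j : ℕ) (x : ℝ) : |iteratedAverage a n j x| ≤ 1 := by
  induction n generalizing j x with
  | zero =>
    have : 0 ≤ |x| := abs_nonneg x
    rw [abs_of_nonneg (iteratedAverage_nonneg 0 j x)]
    exact max_le zero_le_one (by linarith)
  | succ n ih =>
    have h := abs_average_sub_le (a := a j) (u := iteratedAverage a n (j + 1)) (w := fun _ => 0)
      (x := x) (y := x) (C := 1) (iteratedAverage_continuous _ _) continuous_const
      fun s _ => by simpa using ih _ _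
    rwa [average_const, sub_zero] at h

/-- The additional average is the innermost one: it moves the 2-Lipschitz tent by at most 2 a_(j+n),
and the outer averages do not increase the distance. -/
theorem iteratedAverage_succ_sub_le (ha : ∀ j, 0 < a j) (n j : ℕ) (x : ℝ) :
    dist (iteratedAverage a n j x) (iteratedAverage a (n + 1) j x) ≤ 2 * a (j + n) := by
  rw [dist_comm, Real.dist_eq]
  induction n generalizing j x with
  | zero =>
    have h := abs_average_sub_le (a := a j) (u := tent) (w := fun _ => tent x)
      (x := x) (y := x) (C := 2 * a j) (continuous_of_lipschitz_two tent_lipschitz) continuous_const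
      fun s hs => by
        refine (tent_lipschitz _ _).trans ?_
        rw [add_sub_cancel_left, abs_mul, abs_of_pos (ha j)]
        have := mul_le_of_le_one_right (ha j).le (abs_le.2 hs)
        linarith
    rwa [average_const] at h
  | succ n ih =>
    refine abs_average_sub_le (iteratedAverage_continuous _ _) (iteratedAverage_continuous _ _)
      fun s _ => (ih _ _).trans_eq ?_
    congr 2
    ring

theorem iteratedAverage_eq_zero (ha : ∀ j, 0 < a j) (n j : ℕ) (x : ℝ)
    (hx : 1 / 2 + ∑ i ∈ Finset.range n, a (j + i) ≤ |x|) : iteratedAverage a n j x = 0 := by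
  induction n generalizing j x with
  | zero =>
    simp only [Finset.range_zero, Finset.sum_empty, add_zero] at hx
    exact max_eq_left (by linarith)
  | succ n ih =>
    refine average_eq_zero (ha j).le (ih (j + 1)) ?_
    rw [Finset.sum_range_succ'] at hx
    simp only [add_zero, add_assoc, add_comm 1] at hx ⊢
    exact hx

/-- The limit of the iterated averages. -/
noncomputable def infiniteAverage (a : ℕ → ℝ) (j : ℕ) (x : ℝ) : ℝ :=
  Filter.limUnder Filter.atTop fun n => iteratedAverage a n j x

theorem summable_shift_two_mul (hs : Summable a) (j : ℕ) : Summable fun n => 2 * a (j + n) := by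
  have := (summable_nat_add_iff j).2 hs
  simp only [add_comm _ j] at this
  exact this.mul_left 2

theorem tendsto_iteratedAverage (ha : ∀ j, 0 < a j) (hs : Summable a) (j : ℕ) (x : ℝ) :
    Filter.Tendsto (fun n => iteratedAverage a n j x) Filter.atTop (𝓝 (infiniteAverage a j x)) :=
  (cauchySeq_of_dist_le_of_summable _ (fun n => iteratedAverage_succ_sub_le ha n j x)
    (summable_shift_two_mul hs j)).tendsto_limUnder

theorem infiniteAverage_lipschitz (ha : ∀ j, 0 < a j) (hs : Summable a) (j : ℕ) (x y : ℝ) :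
    |infiniteAverage a j x - infiniteAverage a j y| ≤ 2 * |x - y| :=
  le_of_tendsto ((tendsto_iteratedAverage ha hs j x).sub (tendsto_iteratedAverage ha hs j y)).abs
    (Filter.Eventually.of_forall fun n => iteratedAverage_lipschitz n j x y)

theorem infiniteAverage_continuous (ha : ∀ j, 0 < a j) (hs : Summable a) (j : ℕ) :
    Continuous (infiniteAverage a j) :=
  continuous_of_lipschitz_two (infiniteAverage_lipschitz ha hs j)

theorem infiniteAverage_nonneg (ha : ∀ j, 0 < a j) (hs : Summable a) (j : ℕ) (x : ℝ) :
    0 ≤ infiniteAverage a j x :=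
  ge_of_tendsto' (tendsto_iteratedAverage ha hs j x) fun n => iteratedAverage_nonneg n j x

theorem abs_infiniteAverage_le_one (ha : ∀ j, 0 < a j) (hs : Summable a) (j : ℕ) (x : ℝ) :
    |infiniteAverage a j x| ≤ 1 :=
  le_of_tendsto' (tendsto_iteratedAverage ha hs j x).abs fun n => abs_iteratedAverage_le_one n j x

theorem infiniteAverage_eq_zero (ha : ∀ j, 0 < a j) (hs : Summable a) {x : ℝ}
    (hx : 1 / 2 + ∑' j, a j ≤ |x|) : infiniteAverage a 0 x = 0 := by
  refine tendsto_nhds_unique (tendsto_iteratedAverage ha hs 0 x) ?_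
  have : ∀ n, iteratedAverage a n 0 x = 0 := fun n => by
    refine iteratedAverage_eq_zero ha n 0 x (le_trans ?_ hx)
    simp only [zero_add]
    gcongr
    exact hs.sum_le_tsum _ fun i _ => (ha i).le
  simp [this]

theorem le_infiniteAverage_zero (ha : ∀ j, 0 < a j) (hs : Summable a) :
    1 - 2 * ∑' j, a j ≤ infiniteAverage a 0 0 := by
  have h := dist_le_tsum_of_dist_le_of_tendsto₀ _
    (fun n => iteratedAverage_succ_sub_le ha n 0 0) (summable_shift_two_mul hs 0)
    (tendsto_iteratedAverage ha hs 0 0)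
  simp only [zero_add, tsum_mul_left] at h
  have h0 : iteratedAverage a 0 0 0 = 1 := by simp [iteratedAverage, tent]
  rw [h0, Real.dist_eq] at h
  linarith [le_abs_self (1 - infiniteAverage a 0 0)]

theorem infiniteAverage_eq_average (ha : ∀ j, 0 < a j) (hs : Summable a) (j : ℕ) :
    infiniteAverage a j = average (a j) (infiniteAverage a (j + 1)) := by
  funext x
  refine tendsto_nhds_unique
    ((Filter.tendsto_add_atTop_iff_nat 1).2 (tendsto_iteratedAverage ha hs j x)) ?_
  refine Filter.Tendsto.const_mul _ ?_
  refine intervalIntegral.tendsto_integral_filter_of_dominated_convergence (fun _ => 1) ?_ ?_ ?_ ?_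
  · refine Filter.Eventually.of_forall fun n => Continuous.aestronglyMeasurable ?_
    have := iteratedAverage_continuous (a := a) n (j + 1)
    fun_prop
  · exact Filter.Eventually.of_forall fun n => Filter.Eventually.of_forall fun s _ =>
      abs_iteratedAverage_le_one _ _ _
  · exact intervalIntegrable_const
  · exact Filter.Eventually.of_forall fun s _ => tendsto_iteratedAverage ha hs _ _

theorem deriv_infiniteAverage (ha : ∀ j, 0 < a j) (hs : Summable a) (j : ℕ) (x : ℝ) :
    HasDerivAt (infiniteAverage a j)
      ((2 * a j)⁻¹ * (infiniteAverage a (j + 1) (x + a j) - infiniteAverage a (j + 1) (x - a j)))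
      x := by
  rw [← div_eq_inv_mul, infiniteAverage_eq_average ha hs j]
  exact hasDerivAt_average (ha j) (infiniteAverage_continuous ha hs (j + 1)) x

/-- The derivative at index j consists of translates of the limit at index j + 1, so the induction
on the order runs over all j simultaneously. -/
theorem contDiff_infiniteAverage (ha : ∀ j, 0 < a j) (hs : Summable a) (j : ℕ) :
    ContDiff ℝ ∞ (infiniteAverage a j) := by
  rw [contDiff_infty]
  intro m
  induction m generalizing j with
  | zero => exact contDiff_zero.2 (infiniteAverage_continuous ha hs j)
  | succ m ih =>
    have hd := deriv_infiniteAverage ha hs j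
    rw [Nat.cast_succ, contDiff_succ_iff_deriv]
    refine ⟨fun x => (hd x).differentiableAt, by simp, ?_⟩
    rw [funext fun x => (hd x).deriv]
    have := ih (j + 1)
    fun_prop

/-- Each derivative produces two translates with the factor 1/(2a), hence in total one factor 1/a at
each successive index. -/
theorem abs_iteratedDeriv_infiniteAverage_le (ha : ∀ j, 0 < a j) (hs : Summable a) (m j : ℕ)
    (x : ℝ) :
    |iteratedDeriv m (infiniteAverage a j) x| ≤ ∏ i ∈ Finset.range m, (a (j + i))⁻¹ := by
  induction m generalizing j x with
  | zero => simpa using abs_infiniteAverage_le_one ha hs j x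
  | succ m ih =>
    have hsm : ContDiff ℝ m (infiniteAverage a (j + 1)) :=
      (contDiff_infiniteAverage ha hs (j + 1)).of_le (by exact_mod_cast le_top)
    have h1 : ContDiff ℝ m (fun x => infiniteAverage a (j + 1) (x + a j)) := by fun_prop
    have h2 : ContDiff ℝ m (fun x => infiniteAverage a (j + 1) (x - a j)) := by fun_prop
    rw [iteratedDeriv_succ', funext fun x => (deriv_infiniteAverage ha hs j x).deriv,
      iteratedDeriv_const_mul_field, iteratedDeriv_fun_sub h1.contDiffAt h2.contDiffAt,
      iteratedDeriv_comp_add_const, iteratedDeriv_comp_sub_const, abs_mul,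
      abs_of_pos (inv_pos.2 (mul_pos two_pos (ha j))), Finset.prod_range_succ']
    have h3 := abs_sub (iteratedDeriv m (infiniteAverage a (j + 1)) (x + a j))
      (iteratedDeriv m (infiniteAverage a (j + 1)) (x - a j))
    have h4 := ih (j + 1) (x + a j)
    have h5 := ih (j + 1) (x - a j)
    simp only [add_zero, add_assoc, add_comm 1] at h4 h5 ⊢
    have hj := inv_pos.2 (ha j)
    rw [mul_inv]
    calc _ ≤ 2⁻¹ * (a j)⁻¹ * (∏ i ∈ Finset.range m, (a (j + (i + 1)))⁻¹ +
          ∏ i ∈ Finset.range m, (a (j + (i + 1)))⁻¹) := by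
          gcongr
          exact h3.trans (add_le_add h4 h5)
      _ = _ := by ring

end InfiniteAverage

/-- A Denjoy-Carleman class of strongly regular weight contains bump functions. -/
theorem StronglyRegular.exists_bump {N : ℕ → ℝ} (hN : StronglyRegular N) :
    ∃ χ : ℝ → ℝ, ContDiff ℝ ∞ χ ∧ (∀ x, 0 ≤ χ x) ∧ 1 / 2 ≤ χ 0 ∧ (∀ x, 1 ≤ |x| → χ x = 0) ∧
      ∃ σ : ℝ, 0 < σ ∧ ∀ m x, |iteratedDeriv m χ x| ≤ σ ^ m * m.factorial * N m := by
  obtain ⟨A, hA, h⟩ := hN.strongNonQuasianalytic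
  have hs := (h 0).1
  simp only [zero_add] at hs
  set b : ℕ → ℝ := fun j => N j / ((j + 1 : ℝ) * N (j + 1)) with hb
  have hb0 : ∀ j, 0 < b j := fun j => by
    have := hN.pos j
    have := hN.pos (j + 1)
    simp only [hb]
    positivity
  have hS : 0 < ∑' j, b j := hs.tsum_pos (fun j => (hb0 j).le) 0 (hb0 0)
  -- The half-lengths now sum to 1/4: the support lies within 1/2 + 1/4 < 1, and the value at 0 is
  -- at least 1 − 2/4 = 1/2.
  set c : ℝ := (4 * ∑' j, b j)⁻¹ with hc
  have hc0 : 0 < c := by positivity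
  have ha : ∀ j, 0 < c * b j := fun j => mul_pos hc0 (hb0 j)
  have hsa : Summable fun j => c * b j := hs.mul_left c
  have hsum : ∑' j, c * b j = 1 / 4 := by
    rw [tsum_mul_left, hc]
    field_simp
  refine ⟨infiniteAverage (fun j => c * b j) 0, contDiff_infiniteAverage ha hsa 0,
    infiniteAverage_nonneg ha hsa 0, ?_, fun x hx => ?_, c⁻¹, inv_pos.2 hc0, fun m x => ?_⟩
  · have := le_infiniteAverage_zero ha hsa
    rw [hsum] at this
    linarith
  · refine infiniteAverage_eq_zero ha hsa ?_
    rw [hsum]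
    linarith
  -- The product of the (i + 1) N_(i+1)/N_i over i < m telescopes to m! N_m, which motivates the
  -- choice of half-lengths.
  · refine (abs_iteratedDeriv_infiniteAverage_le ha hsa m 0 x).trans_eq ?_
    simp only [zero_add]
    clear x
    induction m with
    | zero => simp [hN.zero]
    | succ m ih =>
      have h1 := hN.pos m
      have h2 := hN.pos (m + 1)
      rw [Finset.prod_range_succ, ih, Nat.factorial_succ]
      simp only [hb]
      push_cast
      rw [pow_succ]
      field_simp

/-! ### Smooth series with geometrically decaying terms, and the pulses -/

section Series

/-- The remainders of the series `∑ e n`. -/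
noncomputable def seriesTail (e : ℕ → ℝ → ℝ) (N : ℕ) (s : ℝ) : ℝ := ∑' n, e (n + N) s

variable {e : ℕ → ℝ → ℝ} {B : ℕ → ℝ}

theorem norm_iteratedFDeriv_shift_le (hb : ∀ n m s, |iteratedDeriv m (e n) s| ≤ (1 / 2) ^ n * B m)
    (N m n : ℕ) (s : ℝ) :
    ‖iteratedFDeriv ℝ m (e (n + N)) s‖ ≤ (1 / 2) ^ n * ((1 / 2) ^ N * B m) := by
  rw [norm_iteratedFDeriv_eq_norm_iteratedDeriv, Real.norm_eq_abs, ← mul_assoc, ← pow_add]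
  exact hb _ _ _

theorem summable_half_pow_mul (c : ℝ) : Summable fun n : ℕ => (1 / 2 : ℝ) ^ n * c :=
  summable_geometric_two.mul_right c

theorem contDiff_seriesTail (he : ∀ n, ContDiff ℝ ∞ (e n))
    (hb : ∀ n m s, |iteratedDeriv m (e n) s| ≤ (1 / 2) ^ n * B m) (N : ℕ) :
    ContDiff ℝ ∞ (seriesTail e N) :=
  contDiff_tsum (fun n => he (n + N)) (fun _ _ => summable_half_pow_mul _)
    fun m n s _ => norm_iteratedFDeriv_shift_le hb N m n s

theorem abs_iteratedDeriv_seriesTail_le (he : ∀ n, ContDiff ℝ ∞ (e n))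
    (hb : ∀ n m s, |iteratedDeriv m (e n) s| ≤ (1 / 2) ^ n * B m) (N m : ℕ) (s : ℝ) :
    |iteratedDeriv m (seriesTail e N) s| ≤ 2 * (1 / 2) ^ N * B m := by
  rw [← Real.norm_eq_abs, ← norm_iteratedFDeriv_eq_norm_iteratedDeriv]
  have h1 : iteratedFDeriv ℝ m (seriesTail e N) s = ∑' n, iteratedFDeriv ℝ m (e (n + N)) s :=
    iteratedFDeriv_tsum_apply (N := ⊤) (fun n => he (n + N))
      (fun _ _ => summable_half_pow_mul _)
      (fun m n s _ => norm_iteratedFDeriv_shift_le hb N m n s) (by exact_mod_cast le_top) s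
  rw [h1]
  refine (tsum_of_norm_bounded (summable_half_pow_mul _).hasSum
    fun n => norm_iteratedFDeriv_shift_le hb N m n s).trans_eq ?_
  rw [tsum_mul_right, tsum_geometric_two]
  ring

theorem summable_of_iteratedDeriv_le
    (hb : ∀ n m s, |iteratedDeriv m (e n) s| ≤ (1 / 2) ^ n * B m) (s : ℝ) :
    Summable fun n => e n s :=
  Summable.of_norm_bounded (summable_half_pow_mul (B 0)) fun n => by simpa using hb n 0 s

theorem seriesTail_zero_sub (hb : ∀ n m s, |iteratedDeriv m (e n) s| ≤ (1 / 2) ^ n * B m)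
    (N : ℕ) (s : ℝ) :
    seriesTail e 0 s - seriesTail e N s = ∑ n ∈ Finset.range N, e n s := by
  rw [sub_eq_iff_eq_add]
  exact ((summable_of_iteratedDeriv_le hb s).sum_add_tsum_nat_add N).symm

theorem le_seriesTail_zero (hb : ∀ n m s, |iteratedDeriv m (e n) s| ≤ (1 / 2) ^ n * B m)
    (h0 : ∀ n s, 0 ≤ e n s) (n : ℕ) (s : ℝ) : e n s ≤ seriesTail e 0 s :=
  (summable_of_iteratedDeriv_le hb s).le_tsum n fun i _ => h0 i s

end Series

/-- Functions in a Denjoy-Carleman class concentrated near the points `2 ^ (-n)`, away from `0`,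
and not too small there. -/
theorem StronglyRegular.exists_pulses {q : ℕ → ℝ} (hq : StronglyRegular q) :
    ∃ e : ℕ → ℝ → ℝ, (∀ n, ContDiff ℝ ∞ (e n)) ∧ (∀ n s, 0 ≤ e n s) ∧
      (∀ n s, s ≤ (1 / 2) ^ (n + 1) → e n s = 0) ∧
      (∃ σ : ℝ, 0 < σ ∧ ∀ n m s,
        |iteratedDeriv m (e n) s| ≤ (1 / 2) ^ n * (σ ^ m * m.factorial * q m ^ 4)) ∧
      ∀ n, ∃ j : ℕ, (1 / 2) ^ n * ((1 / 2) ^ (n + 1)) ^ j * q j ^ 3 / 2 ≤ e n ((1 / 2) ^ n) := by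
  obtain ⟨χ, hχ, hχ0, hχ1, hχs, σ, hσ, hb⟩ := hq.exists_bump
  -- The height of the n-th pulse is the infimum over j of δ^j q_j³ at its width δ = 2^(-n-1), up to
  -- the factor 2^(-n) ensuring convergence. That the infimum is attained gives the lower bound at
  -- the centre.
  have hmin : ∀ n : ℕ, ∃ i, ∀ j, ((1 / 2 : ℝ) ^ (n + 1)) ^ i * q i ^ 3 ≤
      ((1 / 2) ^ (n + 1)) ^ j * q j ^ 3 := fun n => by
    have h : Filter.Tendsto (fun j => ((1 / 2 : ℝ) ^ (n + 1)) ^ j * q j ^ 3) Filter.cofinite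
        Filter.atTop := by
      rw [Nat.cofinite_eq_atTop]
      refine Filter.tendsto_atTop_mono (fun j => ?_)
        (hq.tendsto_pow_mul (by positivity : 0 < (1 / 2 : ℝ) ^ (n + 1)))
      gcongr
      exact le_self_pow₀ (hq.one_le j) (by norm_num)
    exact h.exists_forall_le
  choose i hi using hmin
  set δ : ℕ → ℝ := fun n => (1 / 2) ^ (n + 1) with hδ
  have hδ0 : ∀ n, 0 < δ n := fun n => by positivity
  set α : ℕ → ℝ := fun n => (1 / 2) ^ n * (δ n ^ i n * q (i n) ^ 3) with hα
  have hα0 : ∀ n, 0 < α n := fun n => by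
    have := hq.pos (i n)
    have := hδ0 n
    simp only [hα]
    positivity
  have hsm : ∀ n, ContDiff ℝ ∞ fun s => χ ((δ n)⁻¹ * s) := fun n =>
    hχ.comp (contDiff_const.mul contDiff_id)
  refine ⟨fun n s => α n * χ ((δ n)⁻¹ * (s - (1 / 2) ^ n)), fun n => ?_, fun n s => ?_,
    fun n s hs => ?_, ⟨σ, hσ, fun n m s => ?_⟩, fun n => ⟨i n, ?_⟩⟩
  · exact contDiff_const.mul ((hsm n).comp (contDiff_id.sub contDiff_const))
  · exact mul_nonneg (hα0 n).le (hχ0 _)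
  · simp only
    rw [hχs, mul_zero]
    rw [abs_mul, abs_of_pos (inv_pos.2 (hδ0 n)), inv_mul_eq_div, le_div_iff₀ (hδ0 n), one_mul,
      abs_sub_comm]
    refine le_trans ?_ (le_abs_self _)
    have : (1 / 2 : ℝ) ^ n = 2 * (1 / 2) ^ (n + 1) := by ring
    simp only [hδ]
    linarith
  · rw [iteratedDeriv_const_mul_field,
      iteratedDeriv_comp_sub_const m (fun s => χ ((δ n)⁻¹ * s)),
      iteratedDeriv_comp_const_mul (hχ.of_le (by exact_mod_cast le_top)), abs_mul,
      abs_of_pos (hα0 n)]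
    simp only
    rw [abs_mul, abs_of_pos (pow_pos (inv_pos.2 (hδ0 n)) m)]
    have hd := hδ0 n
    have hqm := hq.pos m
    -- Testing the minimum at the order m of the derivative cancels the δ^(-m) created by rescaling;
    -- the q_m of the bump completes q_m³ to q_m⁴.
    calc _ ≤ (1 / 2) ^ n * (δ n ^ m * q m ^ 3) *
          ((δ n)⁻¹ ^ m * (σ ^ m * m.factorial * q m)) := by
          exact mul_le_mul (mul_le_mul_of_nonneg_left (hi n m) (by positivity))
            (mul_le_mul_of_nonneg_left (hb _ _) (by positivity)) (by positivity) (by positivity)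
      _ = _ := by rw [inv_pow]; field_simp
  · simp only [sub_self, mul_zero]
    calc _ = α n * (1 / 2) := by simp only [hα]; ring
      _ ≤ _ := mul_le_mul_of_nonneg_left hχ1 (hα0 n).le

/-- Convergence in `C_M(ℝⁿ)` follows from uniform estimates on balls. -/
theorem tendsto_classCM {n : ℕ} {M : ℕ → ℝ} (hM : StronglyRegular M) (F : ℕ → ClassCM n M)
    (f : ClassCM n M)
    (h : ∀ r : ℕ+, ∃ σ : ℝ, 0 < σ ∧ ∃ C : ℕ → ℝ, (∀ N, 0 ≤ C N) ∧
      Filter.Tendsto C Filter.atTop (𝓝 0) ∧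
      ∀ N, ∀ J : Fin n → ℕ, ∀ x ∈ Metric.closedBall (0 : EuclideanSpace ℝ (Fin n)) (r : ℝ),
        ‖multiDeriv J (F N) x - multiDeriv J f x‖ ≤ C N * weight M σ J) :
    Filter.Tendsto F Filter.atTop (@nhds _ (ClassCM.topology hM) f) := by
  rw [nhds_iInf, Filter.tendsto_iInf]
  intro r
  set K := Metric.closedBall (0 : EuclideanSpace ℝ (Fin n)) (r : ℝ)
  have hK : IsCompact K := isCompact_closedBall 0 (r : ℝ)
  -- Neighbourhood filters of an infimum of topologies are infima, so it suffices to converge for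
  -- each admissible topology `t`. Norm convergence in a single step space then passes through the
  -- continuous inclusion.
  rw [@nhds_induced _ _ (localTopology hM _), Filter.tendsto_comap_iff, nhds_sInf]
  simp only [Filter.tendsto_iInf]
  intro t ht
  obtain ⟨-, -, -, hcont⟩ := ht
  obtain ⟨σ, hσ, C, hC0, hC, hb⟩ := h r
  obtain ⟨ν₁, hν₁⟩ := (f.restrict K hK).2
  obtain ⟨m, hm⟩ := exists_nat_ge σ
  -- A single step must contain the limit (`ν₁`) and all the differences (index at least `σ`).
  set ν : ℕ+ := max ν₁ m.succPNat
  have hσν : σ ≤ ((ν : ℕ+) : ℝ) := by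
    have h1 : ((m.succPNat : ℕ+) : ℕ) ≤ ν := PNat.coe_le_coe _ _ |>.2 (le_max_right _ _)
    have h2 : ((m.succPNat : ℕ+) : ℝ) ≤ (ν : ℝ) := by exact_mod_cast h1
    rw [Nat.succPNat_coe, Nat.cast_succ] at h2
    linarith
  have hfν : (f.restrict K hK).1 ∈ stepSpace M K ν := stepSpace_mono M K (le_max_left _ _) hν₁
  have hratio : ∀ N p, ratio M K (ν : ℝ) ((F N).restrict K hK - f.restrict K hK).1 p ≤ C N := by
    intro N p
    have hw := weight_pos hM ν p.1
    refine div_le_of_le_mul₀ hw.le (hC0 N) ((hb N p.1 p.2 p.2.2).trans ?_)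
    exact mul_le_mul_of_nonneg_left (weight_mono hσ hσν _ (hM.pos _).le) (hC0 N)
  have hdiff : ∀ N, ((F N).restrict K hK - f.restrict K hK).1 ∈ stepSpace M K ν := by
    intro N
    refine ⟨⟨(1 : ℂ) • (F N).toFun + (-1 : ℂ) • f.toFun,
      (contDiff_const.smul (F N).isClassCM.1).add (contDiff_const.smul f.isClassCM.1), ?_⟩,
      ⟨C N, ?_⟩⟩
    · funext J x
      rw [jetOf, multiDeriv_linear J 1 (-1) (F N).isClassCM.1 f.isClassCM.1]
      simp only [one_smul, neg_smul, Pi.add_apply, Pi.neg_apply, ← sub_eq_add_neg]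
      rfl
    · rintro _ ⟨p, rfl⟩
      exact hratio N p
  have hFν : ∀ N, ((F N).restrict K hK).1 ∈ stepSpace M K ν := fun N => by
    have := Submodule.add_mem _ (hdiff N) hfν
    simpa using this
  have hstep : Filter.Tendsto (fun N => (⟨_, hFν N⟩ : stepSpace M K ν)) Filter.atTop
      (@nhds _ (stepTopology hM K ν) ⟨_, hfν⟩) := by
    let := (stepNorm hM K ν).toAddGroupSeminorm.toSeminormedAddCommGroup
    rw [tendsto_iff_norm_sub_tendsto_zero]
    refine squeeze_zero (fun _ => norm_nonneg _) (fun N => ?_) hC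
    exact Real.iSup_le (hratio N) (hC0 N)
  exact ((@Continuous.tendsto _ _ (stepTopology hM K ν) t _ (hcont ν) _).comp hstep)

/-! ### The zero set and the Łojasiewicz condition -/

theorem zeroSet_exampleFun {k : ℕ} : zeroSet (exampleFun k) = {x | x 0 = 0} := by
  ext x
  simp only [zeroSet, Set.mem_ofPred_eq, exampleFun, Complex.ofReal_eq_zero, mul_eq_zero]
  refine ⟨fun h => h.elim id fun h => ?_, Or.inl⟩
  have h1 := (even_two_mul k).pow_nonneg (x 1)
  have h2 := sq_nonneg (x 0)
  exact pow_eq_zero_iff two_ne_zero |>.1 (by linarith)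

theorem infDist_line (x : EuclideanSpace ℝ (Fin 2)) :
    Metric.infDist x {y : EuclideanSpace ℝ (Fin 2) | y 0 = 0} = |x 0| := by
  refine le_antisymm ?_ ((Metric.le_infDist ⟨0, by simp⟩).2 fun y hy => ?_)
  · have hmem : !₂[0, x 1] ∈ {y : EuclideanSpace ℝ (Fin 2) | y 0 = 0} := by simp
    refine (Metric.infDist_le_dist_of_mem hmem).trans_eq ?_
    rw [EuclideanSpace.dist_eq, Fin.sum_univ_two]
    simp [Real.sqrt_sq_eq_abs]
  · have h := PiLp.norm_apply_le (x - y) 0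
    have hy : y 0 = 0 := hy
    rw [PiLp.sub_apply, hy, sub_zero, ← dist_eq_norm] at h
    exact h

theorem accPt_line {a : EuclideanSpace ℝ (Fin 2)} (ha : a 0 = 0) :
    AccPt a (Filter.principal {y : EuclideanSpace ℝ (Fin 2) | y 0 = 0}) := by
  rw [accPt_iff_nhds]
  intro U hU
  have hc : Filter.Tendsto (fun t : ℝ => a + t • EuclideanSpace.single (1 : Fin 2) (1 : ℝ))
      (𝓝[≠] 0) (𝓝 a) := by
    have h : Continuous (fun t : ℝ => a + t • EuclideanSpace.single (1 : Fin 2) (1 : ℝ)) := by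
      fun_prop
    have := h.tendsto 0
    rw [zero_smul, add_zero] at this
    exact this.mono_left nhdsWithin_le_nhds
  obtain ⟨t, ht, ht0⟩ := ((hc.eventually hU).and self_mem_nhdsWithin).exists
  refine ⟨_, ⟨ht, by simp [ha]⟩, fun h => ht0 ?_⟩
  have := congrArg (fun y : EuclideanSpace ℝ (Fin 2) => y 1) h
  simpa using this

theorem hasTaylorBound_inv_coord {x : EuclideanSpace ℝ (Fin 2)} (hx : x 0 ≠ 0) :
    ContDiffAt ℝ ∞ (fun y : EuclideanSpace ℝ (Fin 2) => ((y 0 : ℝ) : ℂ)⁻¹) x ∧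
    HasTaylorBound (fun _ => 1) (fun y => ((y 0 : ℝ) : ℂ)⁻¹) x |x 0|⁻¹ (4 * |x 0|⁻¹) := by
  have heq : (fun y : EuclideanSpace ℝ (Fin 2) => ((y 0 : ℝ) : ℂ)) =
      fun y => (y 0 : ℂ) ^ 1 * (y 1 : ℂ) ^ 0 := by simp
  have hsm : ContDiff ℝ ∞ (fun y : EuclideanSpace ℝ (Fin 2) => ((y 0 : ℝ) : ℂ)) := by
    rw [heq]
    exact contDiff_tensor (contDiff_ofReal_pow 1) (contDiff_ofReal_pow 0)
  have hne : ((x 0 : ℝ) : ℂ) ≠ 0 := by exact_mod_cast hx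
  have hpos : 0 < |x 0| := abs_pos.2 hx
  have hn : ‖((x 0 : ℝ) : ℂ)‖ = |x 0| := by rw [Complex.norm_real, Real.norm_eq_abs]
  have hev : ∀ᶠ y in 𝓝 x, ((y 0 : ℝ) : ℂ) * ((y 0 : ℝ) : ℂ)⁻¹ = 1 := by
    filter_upwards [hsm.continuous.continuousAt.eventually_ne hne] with y hy
    exact mul_inv_cancel₀ hy
  refine ⟨hsm.contDiffAt.inv hne, ?_⟩
  have := HasTaylorBound.of_mul_eq_one hsm.contDiffAt (hsm.contDiffAt.inv hne) hev
    (inv_nonneg.2 hpos.le) fun a b => by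
      rw [hn, heq, taylorCoeff_tensor (contDiff_ofReal_pow 1) (contDiff_ofReal_pow 0),
        iteratedDeriv_pow_div_factorial, iteratedDeriv_pow_div_factorial]
      obtain rfl | rfl | ⟨a, rfl⟩ : a = 0 ∨ a = 1 ∨ ∃ c, a = c + 2 := by
        rcases a with _ | _ | a <;> simp
      · rcases b with _ | b
        · simp
        · simp
          positivity
      · rcases b with _ | b
        · simp [hpos.ne']
        · simp
          positivity
      · rw [Nat.choose_eq_zero_of_lt (by omega)]
        simp only [Nat.cast_zero, zero_mul, norm_zero]
        positivity
  rwa [hn] at this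

theorem lojasiewiczCondition_exampleFun {M : ℕ → ℝ} (hM : StronglyRegular M) {k : ℕ}
    (hk : 1 ≤ k) : LojasiewiczCondition M (exampleFun k) := by
  refine ⟨isClassCM_exampleFun hM k, fun h => ?_, fun K hK lam hlam => ?_⟩
  · have := congrFun h (EuclideanSpace.single 0 1)
    simp [exampleFun, show k ≠ 0 by omega] at this
  obtain ⟨R, hR⟩ := hK.isBounded.exists_norm_le
  obtain ⟨κ, hκ, hψ⟩ := hasTaylorBound_inv_secondFactor k hk (le_max_right R 1)
  obtain ⟨A, hA, hMA⟩ := hM.moderateGrowth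
  have hM3 := hM.pos 3
  refine ⟨(lam * A) ^ 3 * M 3, by positivity, 8 * κ * lam * A, by positivity, fun J x hx => ?_⟩
  rw [zeroSet_exampleFun] at hx ⊢
  rw [infDist_line]
  obtain ⟨hxK, hx0⟩ := hx
  have hx0 : x 0 ≠ 0 := hx0
  set t := |x 0| with ht
  have htpos : 0 < t := abs_pos.2 hx0
  have hy := (even_two_mul k).pow_nonneg (x 1)
  have hpos : 0 < x 0 ^ 2 + x 1 ^ (2 * k) := by positivity
  set s := √(x 0 ^ 2 + x 1 ^ (2 * k)) with hs
  have hs0 : 0 < s := Real.sqrt_pos.2 hpos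
  have hts : t ≤ s := Real.abs_le_sqrt (by linarith)
  obtain ⟨hd1, hb1⟩ := hψ x (fun i => (PiLp.norm_apply_le x i).trans
    ((hR x hxK).trans (le_max_left _ _))) s hs0 (Real.sq_sqrt hpos.le)
  obtain ⟨hd2, hb2⟩ := hasTaylorBound_inv_coord hx0
  have hone : ∀ _ : ℕ, (0 : ℝ) ≤ 1 := fun _ => zero_le_one
  have hb1' : HasTaylorBound (fun _ => 1) (fun y => (secondFactor k y)⁻¹) x (t ^ 2)⁻¹
      (4 * κ / t) := hb1.mono hone (by positivity) (by positivity) (by gcongr)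
        (by gcongr; linarith)
  have hb2' : HasTaylorBound (fun _ => 1) (fun y => ((y 0 : ℝ) : ℂ)⁻¹) x t⁻¹ (4 * κ / t) :=
    hb2.mono hone (by positivity) (by positivity) le_rfl (by
      rw [← div_eq_mul_inv]
      gcongr
      linarith)
  have hb := (HasTaylorBound.mul hd2 hd1 hone (fun _ _ => by norm_num) (by positivity)
    (by positivity) (by positivity) hb2' hb1').norm_multiDeriv_le J
  have heq : (fun y => 1 / exampleFun k y) =
      fun y => ((y 0 : ℝ) : ℂ)⁻¹ * (secondFactor k y)⁻¹ := by
    funext y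
    rw [exampleFun_eq, one_div, mul_inv]
  rw [heq]
  refine hb.trans ?_
  have hlt : 0 < lam * t := by positivity
  rw [le_div_iff₀ (hM.hFun_pos hlt)]
  set j := len J with hj
  have hMj := hM.pos j
  -- The index j + 3 matches the singularity: t^(-1) from 1/x₁, t^(-2) from 1/ψ, and t^(-j) from the
  -- derivatives. Moderate growth then splits off M_3.
  have h1 := hM.hFun_le hlt (j + 3)
  have h2 := hMA j 3
  unfold weight
  rw [← hj]
  calc _ ≤ t⁻¹ * (t ^ 2)⁻¹ * ((2 * (4 * κ / t)) ^ j * j.factorial * 1) *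
        ((lam * t) ^ (j + 3) * (A ^ (j + 3) * M j * M 3)) := by
        gcongr
        exact h1.trans (by gcongr)
    _ = _ := by
        have e : 2 * (4 * κ / t) = 8 * κ / t := by ring
        rw [e, div_pow, mul_pow (8 * κ * lam) A, mul_pow (8 * κ) lam, mul_pow lam A,
          mul_pow lam t, pow_add t, pow_add lam, pow_add A]
        field_simp

/-! ### Failure of closedness -/

/-- Quotients by the second factor of functions of the second variable supported away from `0`. -/
theorem isClassCM_div_secondFactor {M : ℕ → ℝ} (hM : StronglyRegular M) {k : ℕ} (hk : 1 ≤ k)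
    {u : ℝ → ℝ} (hu : ContDiff ℝ ∞ u) {B σ τ : ℝ} (hB : 0 ≤ B) (hσ : 0 ≤ σ) (hτ : 0 < τ)
    (hb : ∀ m s, |iteratedDeriv m u s| ≤ B * (σ ^ m * m.factorial * M m))
    (h0 : ∀ s ≤ τ, u s = 0) :
    IsClassCM M fun x => (u (x 1) : ℂ) * (secondFactor k x)⁻¹ := by
  have hMM := hM.mul_le
  have hM0 : ∀ j, 0 ≤ M j := fun j => (hM.pos j).le
  have huC : ContDiff ℝ ∞ fun s => (u s : ℂ) := Complex.ofRealCLM.contDiff.comp hu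
  have heq : (fun x : EuclideanSpace ℝ (Fin 2) => (u (x 1) : ℂ)) =
      fun x => (x 0 : ℂ) ^ 0 * (u (x 1) : ℂ) := by simp
  have hu2 : ContDiff ℝ ∞ fun x : EuclideanSpace ℝ (Fin 2) => (u (x 1) : ℂ) := by
    rw [heq]
    exact contDiff_tensor (contDiff_ofReal_pow 0) huC
  -- Below height τ the numerator vanishes, so the convention 0⁻¹ = 0 at the origin is harmless.
  -- Above it, s ≥ τ^k provides one scale valid for all points.
  have hloc : ∀ x : EuclideanSpace ℝ (Fin 2), x 1 < τ →
      (fun x => (u (x 1) : ℂ) * (secondFactor k x)⁻¹) =ᶠ[𝓝 x] fun _ => 0 := fun x hx => by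
    have hc : Continuous fun x : EuclideanSpace ℝ (Fin 2) => x 1 := by fun_prop
    filter_upwards [hc.continuousAt.eventually_lt_const hx] with y hy
    rw [h0 _ hy.le, Complex.ofReal_zero, zero_mul]
  have hs : ∀ x : EuclideanSpace ℝ (Fin 2), τ ≤ x 1 →
      ∃ s, 0 < s ∧ s ^ 2 = x 0 ^ 2 + x 1 ^ (2 * k) ∧ τ ^ k ≤ s := fun x hx => by
    have h1 : τ ^ (2 * k) ≤ x 1 ^ (2 * k) := pow_le_pow_left₀ hτ.le hx _
    have h2 := sq_nonneg (x 0)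
    have h3 : 0 < τ ^ (2 * k) := by positivity
    refine ⟨√(x 0 ^ 2 + x 1 ^ (2 * k)), Real.sqrt_pos.2 (by linarith),
      Real.sq_sqrt (by linarith), Real.le_sqrt_of_sq_le ?_⟩
    rw [← pow_mul, mul_comm k]
    linarith
  refine isClassCM_of_hasTaylorBound (contDiff_iff_contDiffAt.2 fun x => ?_) fun R hR => ?_
  · rcases lt_or_ge (x 1) τ with hx | hx
    · exact contDiffAt_const.congr_of_eventuallyEq (hloc x hx)
    · obtain ⟨s, hs0, hs2, -⟩ := hs x hx
      refine hu2.contDiffAt.mul ((contDiff_secondFactor k).contDiffAt.inv ?_)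
      rw [secondFactor_eq, ← hs2]
      exact_mod_cast (pow_pos hs0 2).ne'
  · obtain ⟨κ, hκ, hψ⟩ := hasTaylorBound_inv_secondFactor k hk hR
    set ρ := max (max 1 σ) (κ / τ ^ k) with hρ
    have hρ1 : 1 ≤ ρ := (le_max_left 1 σ).trans (le_max_left _ _)
    have hρσ : σ ≤ ρ := (le_max_right 1 σ).trans (le_max_left _ _)
    have hρκ : κ / τ ^ k ≤ ρ := le_max_right _ _
    refine ⟨2 * ρ, by positivity, (B + 1) * ((τ ^ k) ^ 2)⁻¹, by positivity, fun x hx => ?_⟩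
    rcases lt_or_ge (x 1) τ with hxτ | hxτ
    · refine HasTaylorBound.congr (fun a b => ?_) (hloc x hxτ)
      rw [taylorCoeff_const, ite_self, norm_zero]
      have := hM0 (a + b)
      positivity
    · obtain ⟨s, hs0, hs2, hτs⟩ := hs x hxτ
      obtain ⟨hd, hb1⟩ := hψ x hx s hs0 hs2
      have hb2 : HasTaylorBound M (fun y => (secondFactor k y)⁻¹) x ((τ ^ k) ^ 2)⁻¹ ρ := by
        intro a b
        refine (hb1 a b).trans (mul_le_mul ?_ (hM.one_le _) zero_le_one (by positivity))
        gcongr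
        refine le_trans ?_ hρκ
        gcongr
      have hb3 : HasTaylorBound M (fun y => (u (y 1) : ℂ)) x (1 * (B + 1)) ρ := by
        rw [heq]
        refine hasTaylorBound_tensor (contDiff_ofReal_pow 0) huC hM0 hMM zero_le_one (by positivity)
          (by positivity) (fun m => ?_) fun m => ?_
        · rw [iteratedDeriv_pow_div_factorial, one_mul]
          have h1 := one_le_mul_of_one_le_of_one_le (one_le_pow₀ hρ1 (n := m)) (hM.one_le m)
          rcases m with _ | m
          · simpa using h1
          · simp only [Nat.choose_zero_succ, Nat.cast_zero, zero_mul, norm_zero]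
            linarith
        · rw [iteratedDeriv_ofReal hu, norm_div, Complex.norm_real, Real.norm_eq_abs,
            Complex.norm_natCast, div_le_iff₀ (by positivity)]
          have := hM0 m
          calc _ ≤ B * (σ ^ m * m.factorial * M m) := hb m _
            _ ≤ (B + 1) * (ρ ^ m * m.factorial * M m) := by
                gcongr
                linarith
            _ = _ := by ring
      rw [one_mul] at hb3
      exact HasTaylorBound.mul hu2.contDiffAt hd hM0 hMM (by positivity) (by positivity)
        (by positivity) hb3 hb2

/-- The bounds for products of the first coordinate and a function of the second one. -/
theorem hasTaylorBound_coord_mul {M : ℕ → ℝ} (hM : StronglyRegular M) {u : ℝ → ℝ}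
    (hu : ContDiff ℝ ∞ u) {B σ R : ℝ} (hB : 0 ≤ B) (hσ : 0 ≤ σ) (hR : 1 ≤ R)
    (hb : ∀ m s, |iteratedDeriv m u s| ≤ B * (σ ^ m * m.factorial * M m))
    {x : EuclideanSpace ℝ (Fin 2)} (hx : ∀ i, |x i| ≤ R) :
    HasTaylorBound M (fun x => (x 0 : ℂ) ^ 1 * (u (x 1) : ℂ)) x (2 ^ 1 * R ^ 1 * B) (max 1 σ) := by
  have hM0 : ∀ j, 0 ≤ M j := fun j => (hM.pos j).le
  refine hasTaylorBound_tensor (contDiff_ofReal_pow 1) (Complex.ofRealCLM.contDiff.comp hu) hM0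
    hM.mul_le (by positivity) hB (by positivity) (fun m => ?_) fun m => ?_
  · refine (norm_iteratedDeriv_pow_div_le hM hR (hx 0) 1 m).trans ?_
    have := hM0 m
    gcongr
    exact le_max_left _ _
  · have e : iteratedDeriv m (⇑Complex.ofRealCLM ∘ u) = _ := iteratedDeriv_ofReal hu m
    rw [e, norm_div, Complex.norm_real, Real.norm_eq_abs,
      Complex.norm_natCast, div_le_iff₀ (by positivity)]
    have := hM0 m
    calc _ ≤ B * (σ ^ m * m.factorial * M m) := hb m _
      _ ≤ B * ((max 1 σ) ^ m * m.factorial * M m) := by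
          gcongr
          exact le_max_right _ _
      _ = _ := by ring

/-- The Taylor coefficients at `(0, t)` of a quotient by the second factor. -/
theorem taylorCoeff_of_secondFactor_mul {k : ℕ} {u : ℝ → ℝ} (hu : ContDiff ℝ ∞ u)
    {g : EuclideanSpace ℝ (Fin 2) → ℂ} (hg : ContDiff ℝ ∞ g)
    (h : ∀ x, secondFactor k x * g x = u (x 1)) (t : ℝ) (m : ℕ) :
    (t : ℂ) ^ (2 * k * (m + 1)) * taylorCoeff g !₂[0, t] (2 * m) 0 = (-1) ^ m * u t := by
  set x : EuclideanSpace ℝ (Fin 2) := !₂[0, t] with hx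
  have hx0 : x 0 = 0 := by simp [hx]
  have hx1 : x 1 = t := by simp [hx]
  have huC : ContDiff ℝ ∞ fun s => (u s : ℂ) := Complex.ofRealCLM.contDiff.comp hu
  have hψ : ∀ a, taylorCoeff (secondFactor k) x a 0 =
      if a = 0 then (t : ℂ) ^ (2 * k) else if a = 2 then 1 else 0 := by
    intro a
    rw [taylorCoeff_secondFactor, hx0, hx1]
    obtain rfl | rfl | rfl | ⟨a, rfl⟩ : a = 0 ∨ a = 1 ∨ a = 2 ∨ ∃ c, a = c + 3 := by
      rcases a with _ | _ | _ | a <;> simp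
    · simp
    · simp
    · simp
    · simp [Nat.choose_eq_zero_of_lt (show 2 < a + 3 by omega)]
  have heq : (fun y => secondFactor k y * g y) = fun y => (y 0 : ℂ) ^ 0 * (u (y 1) : ℂ) := by
    funext y
    simp [h y]
  -- The right side `u (x 1)` does not depend on x₁, so its coefficient of x₁^(a+2) is zero; on the
  -- line x₁ = 0 only the terms x₂^(2k) and x₁² of ψ contribute.
  have hrec : ∀ a, (t : ℂ) ^ (2 * k) * taylorCoeff g x (a + 2) 0 = - taylorCoeff g x a 0 := by
    intro a
    have h1 := taylorCoeff_mul (x := x) (contDiff_secondFactor k).contDiffAt hg.contDiffAt (a + 2) 0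
    rw [heq, taylorCoeff_tensor (contDiff_ofReal_pow 0) huC, iteratedDeriv_pow_div_factorial,
      Finset.Nat.sum_antidiagonal_eq_sum_range_succ_mk, Finset.sum_range_succ',
      Finset.sum_range_succ', Finset.sum_range_succ'] at h1
    simp [hψ] at h1
    linear_combination -h1
  induction m with
  | zero =>
    simp [taylorCoeff_zero_zero]
    have := h x
    rw [secondFactor_eq, hx0, hx1] at this
    simpa using this
  | succ m ih =>
    have h1 := hrec (2 * m)
    have e : 2 * (m + 1) = 2 * m + 2 := by ring
    have e2 : 2 * k * (m + 1 + 1) = 2 * k * (m + 1) + 2 * k := by ring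
    rw [e, e2, pow_add, mul_assoc, h1, pow_succ]
    linear_combination -ih

/-- Incompatibility of the lower bound for flat functions and the upper bound for quotients. -/
theorem StronglyRegular.false_of_bounds {q : ℕ → ℝ} (hq : StronglyRegular q) {k : ℕ} (hk : 2 ≤ k)
    {C τ : ℝ} (hC : 0 < C) (hτ : 0 < τ) {v : ℕ → ℝ}
    (hlow : ∀ n, ∃ j : ℕ, (1 / 2) ^ n * ((1 / 2) ^ (n + 1)) ^ j * q j ^ 3 / 2 ≤ v n)
    (hup : ∀ n m : ℕ, v n ≤ ((1 / 2) ^ n) ^ (2 * k * (m + 1)) * (C * τ ^ (2 * m) * q (2 * m) ^ 4)) :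
    False := by
  set D := 2 + 2 * C + τ with hD
  have hD0 : 0 < D := by positivity
  have hD1 : 1 ≤ D := by linarith
  -- The index j below depends on n, so t = 2^(-n) must be small independently of j: t D^8 < 1,
  -- where 8 comes from 2j + 1 ≤ 8d.
  obtain ⟨n, hn⟩ := exists_pow_lt_of_lt_one (inv_pos.2 (pow_pos hD0 8)) one_half_lt_one
  obtain ⟨j, hj⟩ := hlow n
  -- With m = ⌊3j/8⌋ one has 2m ≤ 3j/4, so q_(2m)⁴ ≤ q_j³. The exponent 4m + 4 nevertheless exceeds
  -- j + 1 by some d ≥ (j + 1)/4, enough to beat constants geometric in j.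
  obtain ⟨m, d, hd, hd1, hjd, hmj, hmj'⟩ : ∃ m d : ℕ, 4 * m + 4 = d + (j + 1) ∧ 1 ≤ d ∧
      j + 1 ≤ 4 * d ∧ 2 * m ≤ j ∧ 4 * (2 * m) ≤ 3 * j :=
    ⟨3 * j / 8, 4 * (3 * j / 8) + 3 - j, by omega, by omega, by omega, by omega, by omega⟩
  have h1 := hj.trans (hup n m)
  set t : ℝ := (1 / 2) ^ n with ht
  have ht0 : 0 < t := by positivity
  have ht1 : t ≤ 1 := pow_le_one₀ (by norm_num) (by norm_num)
  have hQ : 0 < q j ^ 3 := pow_pos (hq.pos j) 3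
  have h2 : t ^ (j + 1) * (2⁻¹ ^ j * (q j ^ 3 / 2)) ≤
      t ^ (j + 1) * (t ^ d * (C * D ^ j * q j ^ 3)) := by
    calc _ = t * ((1 / 2) ^ (n + 1)) ^ j * q j ^ 3 / 2 := by
          rw [pow_succ (1 / 2 : ℝ) n, ← ht, mul_pow]
          ring
      _ ≤ t ^ (2 * k * (m + 1)) * (C * τ ^ (2 * m) * q (2 * m) ^ 4) := h1
      _ ≤ t ^ (4 * m + 4) * (C * D ^ j * q j ^ 3) := by
          -- The hypothesis k ≥ 2 enters here, as 2k ≥ 4.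
          have hk' : 4 * m + 4 ≤ 2 * k * (m + 1) := by nlinarith
          have e1 : t ^ (2 * k * (m + 1)) ≤ t ^ (4 * m + 4) :=
            pow_le_pow_of_le_one ht0.le ht1 hk'
          have e2 : τ ^ (2 * m) ≤ D ^ j :=
            (pow_le_pow_left₀ hτ.le (by linarith) _).trans (pow_le_pow_right₀ hD1 hmj)
          have e3 := hq.pow_four_le_pow_three hmj'
          have := hq.pos (2 * m)
          gcongr
      _ = _ := by rw [hd, pow_add]; ring
  have h3 := le_of_mul_le_mul_left h2 (by positivity)
  have h4 : 1 ≤ t ^ d * (2 * C * (D ^ j * 2 ^ j)) := by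
    have h5 : q j ^ 3 * 1 ≤ q j ^ 3 * (t ^ d * (2 * C * (D ^ j * 2 ^ j))) := by
      have h6 := mul_le_mul_of_nonneg_left h3 (by positivity : (0 : ℝ) ≤ 2 * 2 ^ j)
      calc _ = 2 * 2 ^ j * (2⁻¹ ^ j * (q j ^ 3 / 2)) := by
            rw [inv_pow]
            field_simp
        _ ≤ _ := h6
        _ = _ := by ring
    exact le_of_mul_le_mul_left h5 hQ
  have h7 : 2 * C * (D ^ j * 2 ^ j) ≤ (D ^ 8) ^ d := by
    calc _ ≤ D * (D ^ j * D ^ j) := by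
          gcongr <;> linarith
      _ = D ^ (2 * j + 1) := by ring
      _ ≤ D ^ (8 * d) := pow_le_pow_right₀ hD1 (by omega)
      _ = _ := pow_mul _ _ _
  have h8 : t ^ d * (D ^ 8) ^ d < 1 := by
    rw [← mul_pow]
    refine pow_lt_one₀ (by positivity) ?_ (by omega)
    rwa [← one_div, lt_div_iff₀ (by positivity)] at hn
  have h9 := mul_le_mul_of_nonneg_left h7 (pow_nonneg ht0.le d)
  linarith

theorem isClassCM_coord_mul {M : ℕ → ℝ} (hM : StronglyRegular M) {u : ℝ → ℝ}
    (hu : ContDiff ℝ ∞ u) {B σ : ℝ} (hB : 0 < B) (hσ : 0 ≤ σ)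
    (hb : ∀ m s, |iteratedDeriv m u s| ≤ B * (σ ^ m * m.factorial * M m)) :
    IsClassCM M fun x : EuclideanSpace ℝ (Fin 2) => (x 0 : ℂ) ^ 1 * (u (x 1) : ℂ) :=
  isClassCM_of_hasTaylorBound
    (contDiff_tensor (contDiff_ofReal_pow 1) (Complex.ofRealCLM.contDiff.comp hu)) fun _ hR =>
    ⟨max 1 σ, by positivity, _, by positivity,
      fun _ hx => hasTaylorBound_coord_mul hM hu hB.le hσ hR hb hx⟩

/-- Division by the first coordinate in the principal ideal of the example. -/
theorem secondFactor_mul_eq {k : ℕ} {u : ℝ → ℝ} {g : EuclideanSpace ℝ (Fin 2) → ℂ}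
    (hg : Continuous g) (h : ∀ x, (x 0 : ℂ) ^ 1 * (u (x 1) : ℂ) = exampleFun k x * g x)
    (x : EuclideanSpace ℝ (Fin 2)) : secondFactor k x * g x = u (x 1) := by
  have hc : Continuous (fun t : ℝ => x + t • EuclideanSpace.single (0 : Fin 2) (1 : ℝ)) := by
    fun_prop
  -- On the line through x parallel to the x₁-axis, x₁ can be cancelled except at one parameter;
  -- continuity fills in that value.
  have h1 := Continuous.ext_on (dense_compl_singleton (-x 0))
    (((contDiff_secondFactor k).continuous.mul hg).comp hc)
    (continuous_const (y := (u (x 1) : ℂ))) fun t ht => by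
      set y := x + t • EuclideanSpace.single (0 : Fin 2) (1 : ℝ) with hy
      have hy1 : y 1 = x 1 := by simp [hy]
      have hy0 : (y 0 : ℂ) ≠ 0 := by
        have : y 0 = x 0 + t := by simp [hy]
        rw [this]
        intro h0
        exact ht (eq_neg_of_add_eq_zero_right (by exact_mod_cast h0))
      have h2 := h y
      rw [exampleFun_eq, pow_one, mul_assoc, hy1] at h2
      exact (mul_left_cancel₀ hy0 h2).symm
  simpa using congrFun h1 0

theorem not_isClosed_principalIdeal_exampleFun {M : ℕ → ℝ} (hM : StronglyRegular M) {k : ℕ}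
    (hk : 2 ≤ k) :
    ¬ IsClosed[ClassCM.topology hM] (principalIdeal M (exampleFun k)) := by
  intro hclosed
  -- Fourth roots: the pulses spend q³ on their height and q on the bump, and q⁴ = M.
  have hq := hM.sqrt.sqrt
  have hq4 : ∀ j, √√(M j) ^ 4 = M j := fun j => by
    rw [show 4 = 2 * 2 by norm_num, pow_mul, Real.sq_sqrt (Real.sqrt_nonneg _),
      Real.sq_sqrt (hM.pos j).le]
  obtain ⟨e, he, he0, hes, ⟨σ, hσ, hb⟩, hlow⟩ := hq.exists_pulses
  simp only [hq4] at hb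
  have hB : ∀ m : ℕ, 0 ≤ σ ^ m * m.factorial * M m := fun m => by
    have := hM.pos m
    positivity
  have hE := contDiff_seriesTail he hb
  have hEb := abs_iteratedDeriv_seriesTail_le he hb
  have hS : ∀ N, ContDiff ℝ ∞ fun s => seriesTail e 0 s - seriesTail e N s :=
    fun N => (hE 0).sub (hE N)
  have hSb : ∀ N m s, |iteratedDeriv m (fun s => seriesTail e 0 s - seriesTail e N s) s| ≤
      4 * (σ ^ m * m.factorial * M m) := fun N m s => by
    have hm : ((m : ℕ∞) : ℕ∞ω) ≤ ∞ := by exact_mod_cast le_top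
    rw [iteratedDeriv_fun_sub ((hE 0).of_le hm).contDiffAt ((hE N).of_le hm).contDiffAt]
    refine (abs_sub _ _).trans ((add_le_add (hEb 0 m s) (hEb N m s)).trans ?_)
    have h1 : (1 / 2 : ℝ) ^ N ≤ 1 := pow_le_one₀ (by norm_num) (by norm_num)
    have h2 := mul_le_mul_of_nonneg_right h1 (hB m)
    rw [pow_zero]
    linarith
  -- The last pulse of the partial sum has index N − 1 and vanishes for s ≤ 2^(-N).
  have hS0 : ∀ N, ∀ s ≤ (1 / 2 : ℝ) ^ N, seriesTail e 0 s - seriesTail e N s = 0 := by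
    intro N s hs
    rw [seriesTail_zero_sub hb]
    refine Finset.sum_eq_zero fun n hn => hes n s (hs.trans ?_)
    exact pow_le_pow_of_le_one (by norm_num) (by norm_num) (Finset.mem_range.1 hn)
  have hE0b : ∀ m s, |iteratedDeriv m (seriesTail e 0) s| ≤ 2 * (σ ^ m * m.factorial * M m) :=
    fun m s => by simpa using hEb 0 m s
  let f : ClassCM 2 M := ⟨_, isClassCM_coord_mul hM (hE 0) two_pos hσ.le hE0b⟩
  let F : ℕ → ClassCM 2 M := fun N => ⟨_, isClassCM_coord_mul hM (hS N) four_pos hσ.le (hSb N)⟩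
  have hF : ∀ N, F N ∈ principalIdeal M (exampleFun k) := by
    intro N
    refine ⟨⟨_, isClassCM_div_secondFactor hM (one_le_two.trans hk) (hS N) (by norm_num) hσ.le
      (by positivity) (hSb N) (hS0 N)⟩, fun x => ?_⟩
    simp only [F]
    rw [exampleFun_eq, pow_one]
    -- Where ψ vanishes, x₂ = 0 and both sides are 0; elsewhere the quotient is genuine.
    by_cases hψ : secondFactor k x = 0
    · have hx1 : x 1 = 0 := by
        rw [secondFactor_eq, Complex.ofReal_eq_zero] at hψ
        have h1 := (even_two_mul k).pow_nonneg (x 1)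
        have h2 := sq_nonneg (x 0)
        exact pow_eq_zero_iff (n := 2 * k) (by omega) |>.1 (by linarith)
      rw [hS0 N (x 1) (by rw [hx1]; positivity)]
      simp
    · field_simp
  have hlim : Filter.Tendsto F Filter.atTop (@nhds _ (ClassCM.topology hM) f) := by
    refine tendsto_classCM hM F f fun r => ?_
    have hr : (1 : ℝ) ≤ r := by exact_mod_cast one_le (a := r)
    refine ⟨max 1 σ, by positivity, fun N => 2 ^ 1 * (r : ℝ) ^ 1 * (2 * (1 / 2) ^ N),
      fun N => by positivity, ?_, fun N J x hx => ?_⟩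
    · have h := (tendsto_pow_atTop_nhds_zero_of_lt_one (r := (1 / 2 : ℝ)) (by norm_num)
        (by norm_num)).const_mul (2 ^ 1 * (r : ℝ) ^ 1 * 2)
      rw [mul_zero] at h
      exact h.congr fun N => by ring
    · have hxr : ∀ i, |x i| ≤ (r : ℝ) := fun i =>
        (PiLp.norm_apply_le x i).trans (mem_closedBall_zero_iff.1 hx)
      have hT := (hasTaylorBound_coord_mul hM (hE N) (B := 2 * (1 / 2) ^ N) (by positivity)
        hσ.le hr (hEb N) hxr).norm_multiDeriv_le J
      have hsm : ContDiff ℝ ∞ (fun x : EuclideanSpace ℝ (Fin 2) =>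
          (x 0 : ℂ) ^ 1 * (seriesTail e N (x 1) : ℂ)) :=
        contDiff_tensor (contDiff_ofReal_pow 1) (Complex.ofRealCLM.contDiff.comp (hE N))
      have hsplit : f.toFun = (1 : ℂ) • (F N).toFun + (1 : ℂ) • fun x =>
          (x 0 : ℂ) ^ 1 * (seriesTail e N (x 1) : ℂ) := by
        funext y
        simp only [f, F, Pi.add_apply, one_smul]
        push_cast
        ring
      rw [hsplit, multiDeriv_linear J 1 1 (F N).isClassCM.1 hsm]
      simp only [one_smul, Pi.add_apply, sub_add_cancel_left, norm_neg]
      exact hT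
  obtain ⟨g, hg⟩ : f ∈ principalIdeal M (exampleFun k) := by
    let _ : TopologicalSpace (ClassCM 2 M) := ClassCM.topology hM
    exact IsClosed.mem_of_tendsto hclosed hlim (Filter.Eventually.of_forall hF)
  have hgs := g.isClassCM.1
  have hψg := secondFactor_mul_eq hgs.continuous hg
  -- The unit ball contains all points (0, 2^(-n)), so the constants for g are independent of n;
  -- passing to Taylor coefficients replaces τ by 2τ.
  obtain ⟨τ, hτ, C, hC, hgb⟩ := g.isClassCM.2 _
    (isCompact_closedBall (0 : EuclideanSpace ℝ (Fin 2)) 1)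
  refine hq.false_of_bounds hk hC (mul_pos two_pos hτ)
    (v := fun n => seriesTail e 0 ((1 / 2) ^ n)) (fun n => ?_) fun n m => ?_
  · obtain ⟨j, hj⟩ := hlow n
    exact ⟨j, hj.trans (le_seriesTail_zero hb he0 n _)⟩
  · set t : ℝ := (1 / 2) ^ n with ht
    have ht0 : 0 < t := by positivity
    have ht1 : t ≤ 1 := pow_le_one₀ (by norm_num) (by norm_num)
    have hmem : !₂[0, t] ∈ Metric.closedBall (0 : EuclideanSpace ℝ (Fin 2)) 1 := by
      rw [mem_closedBall_zero_iff, EuclideanSpace.norm_eq, Fin.sum_univ_two]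
      simpa [Real.sqrt_sq_eq_abs, abs_of_pos ht0] using ht1
    have hT := hasTaylorBound_of_norm_multiDeriv_le (fun j => (hM.pos j).le) hC.le hτ.le
      (fun J => hgb J _ hmem) (2 * m) 0
    have hU := congrArg norm (taylorCoeff_of_secondFactor_mul (hE 0) hgs hψg t m)
    rw [norm_mul, norm_mul, norm_pow, norm_pow, norm_neg, norm_one, one_pow, one_mul,
      Complex.norm_real, Complex.norm_real, Real.norm_eq_abs, Real.norm_eq_abs,
      abs_of_pos ht0] at hU
    simp only [hq4]
    refine (le_abs_self _).trans (hU.symm.le.trans ?_)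
    gcongr
    exact hT

end DenjoyCarleman

theorem mainTheorem5 (M : ℕ → ℝ) (hM : DenjoyCarleman.StronglyRegular M) (k : ℕ) (hk : 2 ≤ k) :
    DenjoyCarleman.zeroSet (DenjoyCarleman.exampleFun k) = {x | x 0 = 0} ∧
      (∀ x, Metric.infDist x (DenjoyCarleman.zeroSet (DenjoyCarleman.exampleFun k)) = |x 0|) ∧
      (∀ a ∈ DenjoyCarleman.zeroSet (DenjoyCarleman.exampleFun k),
        AccPt a (Filter.principal (DenjoyCarleman.zeroSet (DenjoyCarleman.exampleFun k)))) ∧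
      DenjoyCarleman.LojasiewiczCondition M (DenjoyCarleman.exampleFun k) ∧
      ¬ IsClosed[DenjoyCarleman.ClassCM.topology hM]
        (DenjoyCarleman.principalIdeal M (DenjoyCarleman.exampleFun k)) := by
  have hz := DenjoyCarleman.zeroSet_exampleFun (k := k)
  refine ⟨hz, ?_, ?_, DenjoyCarleman.lojasiewiczCondition_exampleFun hM (by omega),
    DenjoyCarleman.not_isClosed_principalIdeal_exampleFun hM hk⟩
  · rw [hz]
    exact DenjoyCarleman.infDist_line
  · rw [hz]
    exact fun a ha => DenjoyCarleman.accPt_line ha
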